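/- \textbf{Definitions.} A field $K$ is \emph{Hilbertian} if every separable Hilbert set of $K$ is nonempty: for all integers $r,m\ge 0$, all polynomials $f_1,\dots,f_m$ in one variable $X$ with coefficients in $K[T_1,\dots,T_r]$ that are irreducible and separable as elements of $K(T_1,\dots,T_r)[X]$, and every nonzero $g\in K[T_1,\dots,T_r]$, there is $a\in K^r$ such that $g(a)\neq 0$ and $f_1(a,X),\dots,f_m(a,X)$ are irreducible in $K[X]$. A profinite group $G$ is \emph{Galois-Hilbertian} if for every closed normal subgroup $H$ of $G$ the following holds: if $K$ is a Hilbertian field and $L/K$ is a (possibly infinite) Galois extension whose Galois group, with the Krull topology, is isomorphic to $G/H$ as a topological group, then $L$ is Hilbertian. A topological group $G$ is \emph{$1$-stage} if it is trivial or is isomorphic, as a topological group, to a (possibly infinite) direct product, with the product topology, of finite discrete simple groups (groups of prime order included). For $k\ge 2$, a topological group $G$ is \emph{$k$-stage} if it has a closed normal subgroup $G'$ such that $G'$ is $1$-stage and $G/G'$ is $(k-1)$-stage. \textbf{Proposition.} For every integer $k\ge 1$, every $k$-stage topological group is profinite and Galois-Hilbertian. -/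

import Mathlib

universe u v w

/-- The Hilbert subset of `K ^ r` attached to polynomials `f 1, …, f m` in one variable `X` over
`K[T_1, …, T_r]` and to `g ∈ K[T_1, …, T_r]`: the points `a` with `g(a) ≠ 0` at which all the
`f i (a, X)` are irreducible in `K[X]`. -/
def hilbertSet {K : Type u} [Field K] {r m : ℕ}
    (f : Fin m → Polynomial (MvPolynomial (Fin r) K)) (g : MvPolynomial (Fin r) K) :
    Set (Fin r → K) :=
  {a | MvPolynomial.eval a g ≠ 0 ∧ ∀ i, Irreducible ((f i).map (MvPolynomial.eval a))}

/-- A field `K` is Hilbertian if every separable Hilbert subset of every `K ^ r` is nonempty, that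
is, if `hilbertSet f g` is nonempty for every `g ≠ 0` and all finite families `f` of polynomials
that are irreducible and separable in `X` over the rational function field `K(T_1, …, T_r)`.
Allowing coefficients in `K(T_1, …, T_r)` gives the same notion: multiply by a common denominator
`d` of the coefficients, and replace `g` by `g * d`. -/
def IsHilbertian (K : Type u) [Field K] : Prop :=
  ∀ (r m : ℕ) (f : Fin m → Polynomial (MvPolynomial (Fin r) K)) (g : MvPolynomial (Fin r) K),
    g ≠ 0 →
    (∀ i, Irreducible
        ((f i).map (algebraMap (MvPolynomial (Fin r) K) (FractionRing (MvPolynomial (Fin r) K))))) →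
    (∀ i,
        ((f i).map
          (algebraMap (MvPolynomial (Fin r) K)
            (FractionRing (MvPolynomial (Fin r) K)))).Separable) →
    (hilbertSet f g).Nonempty

/-- A topological group is 1-stage if it is trivial, or isomorphic as a topological group to a
(possibly infinite) direct product of finite simple groups, each discrete, with the product
topology. Simple groups of prime order are included. -/
def IsOneStage (G : Type u) [Group G] [TopologicalSpace G] : Prop :=
  Subsingleton G ∨
    ∃ (I : Type u) (S : I → Type u) (_ : ∀ i, Group (S i)) (_ : ∀ i, TopologicalSpace (S i)),
      (∀ i, DiscreteTopology (S i)) ∧ (∀ i, Finite (S i)) ∧ (∀ i, IsSimpleGroup (S i)) ∧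
        Nonempty (G ≃ₜ* (∀ i, S i))

/-- `IsStage k G`: the topological group `G` is `k`-stage (never the case for `k = 0`). It is
`(k + 1)`-stage, for `k ≥ 1`, if it has a closed normal subgroup `N` such that `N` is 1-stage and
`G ⧸ N` is `k`-stage. -/
inductive IsStage : ℕ → (G : Type u) → [Group G] → [TopologicalSpace G] → Prop
  | one (G : Type u) [Group G] [TopologicalSpace G] (h : IsOneStage G) : IsStage 1 G
  | succ (k : ℕ) (G : Type u) [Group G] [TopologicalSpace G] (N : Subgroup G) [N.Normal]
      (hclosed : IsClosed (N : Set G)) (hN : IsOneStage N) (hquot : IsStage k (G ⧸ N)) :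
      IsStage (k + 1) G

/-- A topological group `G` is Galois-Hilbertian if it is profinite and, for every closed normal
subgroup `H` of `G`, every Galois extension `L` of a Hilbertian field `K` whose Galois group (with
the Krull topology) is isomorphic to `G ⧸ H` as a topological group is Hilbertian. -/
structure IsGaloisHilbertian (G : Type u) [Group G] [TopologicalSpace G] : Prop where
  isTopologicalGroup : IsTopologicalGroup G
  compactSpace : CompactSpace G
  t2Space : T2Space G
  totallyDisconnectedSpace : TotallyDisconnectedSpace G
  isHilbertian_of_gal : ∀ (H : Subgroup G) [H.Normal], IsClosed (H : Set G) →
    ∀ (K : Type v) (L : Type w) [Field K] [Field L] [Algebra K L] [IsGalois K L],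
      IsHilbertian K → Nonempty (Gal(L/K) ≃ₜ* (G ⧸ H)) → IsHilbertian L

open Polynomial

/-! The engine is a criterion for a Galois extension L of a Hilbertian field K: L is Hilbertian as
soon as some σ ≠ 1 in Gal(L/K) commutes with every automorphism fixing a finite set Y ⊆ L
(`IsHilbertian.of_exists_gal_commute`). Choose α with σα ≠ α and look for good points of the form a
= b₀ + αb₁ with b₀, b₁ rational over K. A proper monic factor q of f(a, X) over L has coefficients c
= φ(y), where φ specializes (t, t') to (b₀, b₁) and y is a coefficient of a partial product of
linear factors of f(t + αt', X). The conjugate q^σ divides f^σ(b₀ + σ(α)b₁, X), so σc lies in the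
field M generated over K by Y and the roots of that polynomial. If c ∉ M, some g in Gal(L/K) moves c
and fixes L ∩ M; then g commutes with σ and fixes σc, hence fixes c, a contradiction.

So b must be chosen to keep c out of M or out of L. Generically y lies outside the analogue of M,
because the pencils t + αt' and t + σ(α)t' are independent (`mem_range_of_smul_mem_adjoin`), unless
y is a polynomial over the algebraically closed constant field. In the first case Hilbertianity of K
preserves the non-membership (`IsHilbertian.exists_specialization_notMem`). In the second, y has a
coefficient outside L, so its values avoid L off a hypersurface over K
(`MvPolynomial.exists_forall_eval_notMem`).

The criterion applies when Gal(L/K) has a nontrivial finite normal subgroup, since such a subgroup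
has open centralizer. A nontrivial continuous image of a product of finite groups contains one: the
image of some factor. The stages are then climbed by induction, through the fixed field of the image
of N. -/

/-! ### Integral extensions and products of linear factors -/

theorem Multiset.exists_le_map_eq {α β : Type*} (f : α → β) (s : Multiset α) (t : Multiset β)
    (h : t ≤ s.map f) : ∃ u ≤ s, u.map f = t := by
  classical
  induction s using Multiset.induction_on generalizing t with
  | empty => simp at h; subst h; exact ⟨0, by simp⟩
  | cons a s ih =>
    by_cases ha : f a ∈ t
    · obtain ⟨t', rfl⟩ := Multiset.exists_cons_of_mem ha
      rw [Multiset.map_cons, Multiset.cons_le_cons_iff] at h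
      obtain ⟨u, hu, rfl⟩ := ih _ h
      exact ⟨a ::ₘ u, (Multiset.cons_le_cons_iff a).2 hu, by simp⟩
    · rw [Multiset.map_cons, Multiset.le_cons_of_notMem ha] at h
      obtain ⟨u, hu, rfl⟩ := ih _ h
      exact ⟨u, hu.trans (Multiset.le_cons_self _ _), rfl⟩

theorem exists_ringHom_extension_of_injective {R B k : Type*} [CommRing R] [IsDomain R] [CommRing B]
    [IsDomain B] [Algebra R B] [Algebra.IsIntegral R B] [Field k] [IsAlgClosed k]
    (hinj : Function.Injective (algebraMap R B)) (f : R →+* k) (hf : Function.Injective f) :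
    ∃ φ : B →+* k, φ.comp (algebraMap R B) = f := by
  let _ : Algebra R k := f.toAlgebra
  have : FaithfulSMul R B := (faithfulSMul_iff_algebraMap_injective R B).2 hinj
  have : FaithfulSMul R k := (faithfulSMul_iff_algebraMap_injective R k).2 hf
  let φ : B →ₐ[R] k := IsAlgClosed.lift
  exact ⟨φ.toRingHom, RingHom.ext fun r => φ.commutes r⟩

/-- A ring homomorphism to an algebraically closed field extends along integral extensions. -/
theorem exists_ringHom_extension {R B k : Type*} [CommRing R] [CommRing B] [Algebra R B]
    [Algebra.IsIntegral R B] [Field k] [IsAlgClosed k]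
    (hinj : Function.Injective (algebraMap R B)) (f : R →+* k) :
    ∃ φ : B →+* k, φ.comp (algebraMap R B) = f := by
  have hP : (RingHom.ker f).IsPrime := RingHom.ker_isPrime f
  -- A prime `Q` lying over the kernel reduces to an injective map between domains, where lifting of
  -- algebraic extensions is available.
  obtain ⟨Q, -, hQ, hQP⟩ := Ideal.exists_ideal_over_prime_of_isIntegral (S := B) (RingHom.ker f) ⊥
    (by
      rw [← RingHom.ker_eq_comap_bot, (RingHom.injective_iff_ker_eq_bot _).1 hinj]
      exact bot_le)
  let i : R ⧸ RingHom.ker f →+* B ⧸ Q := Ideal.quotientMap Q (algebraMap R B) hQP.ge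
  let _ : Algebra (R ⧸ RingHom.ker f) (B ⧸ Q) := i.toAlgebra
  have hi : Function.Injective (algebraMap (R ⧸ RingHom.ker f) (B ⧸ Q)) :=
    Ideal.quotientMap_injective' (J := RingHom.ker f) (I := Q) (f := algebraMap R B)
      (H := hQP.ge) hQP.le
  have : Algebra.IsIntegral (R ⧸ RingHom.ker f) (B ⧸ Q) := ⟨fun x => by
    obtain ⟨b, rfl⟩ := Ideal.Quotient.mk_surjective x
    obtain ⟨p, hp, hpb⟩ := Algebra.IsIntegral.isIntegral (R := R) b
    refine ⟨p.map (Ideal.Quotient.mk _), hp.map _, ?_⟩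
    rw [Polynomial.eval₂_map]
    have : (algebraMap (R ⧸ RingHom.ker f) (B ⧸ Q)).comp (Ideal.Quotient.mk (RingHom.ker f))
        = (Ideal.Quotient.mk Q).comp (algebraMap R B) := by
      ext r; rfl
    rw [this, ← Polynomial.hom_eval₂, hpb, map_zero]⟩
  obtain ⟨φ, hφ⟩ := exists_ringHom_extension_of_injective hi (RingHom.kerLift f)
    (RingHom.kerLift_injective f)
  refine ⟨φ.comp (Ideal.Quotient.mk Q), ?_⟩
  ext r
  exact congrArg (fun h => h (Ideal.Quotient.mk _ r)) hφ

/-- The coefficients of a product of linear factors lie in every subring containing the roots. -/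
theorem coeff_prod_X_sub_C_mem {B : Type*} [CommRing B] (U : Subring B) (s : Multiset B)
    (h : ∀ x ∈ s, x ∈ U) (j : ℕ) : (s.map (fun x => X - C x)).prod.coeff j ∈ U := by
  induction s using Multiset.induction_on generalizing j with
  | empty =>
    simp only [Multiset.map_zero, Multiset.prod_zero, coeff_one]
    split_ifs
    exacts [U.one_mem, U.zero_mem]
  | cons a s ih =>
    have ih' := ih (fun x hx => h x (Multiset.mem_cons_of_mem hx))
    rw [Multiset.map_cons, Multiset.prod_cons, sub_mul, coeff_sub, coeff_C_mul]
    refine U.sub_mem ?_ (U.mul_mem (h a (Multiset.mem_cons_self _ _)) (ih' j))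
    cases j with
    | zero => simp
    | succ j => rw [coeff_X_mul]; exact ih' j

theorem monic_prod_X_sub_C {B : Type*} [CommRing B] (s : Multiset B) :
    (s.map (fun x => X - C x)).prod.Monic := monic_multiset_prod_of_monic _ _ fun x _ => monic_X_sub_C x

theorem natDegree_prod_X_sub_C {B : Type*} [CommRing B] [Nontrivial B] (s : Multiset B) :
    (s.map (fun x => X - C x)).prod.natDegree = s.card :=
  Polynomial.natDegree_multiset_prod_X_sub_C_eq_card s

theorem map_prod_X_sub_C {B B' : Type*} [CommRing B] [CommRing B'] (φ : B →+* B')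
    (s : Multiset B) :
    (s.map (fun x => X - C x)).prod.map φ = ((s.map φ).map (fun x => X - C x)).prod := by
  rw [Polynomial.map_multiset_prod, Multiset.map_map, Multiset.map_map]
  simp

/-- Monic polynomials over an integrally closed subring of an algebraically closed field are
products of linear factors. -/
theorem exists_eq_prod_X_sub_C {B Ω : Type*} [CommRing B] [Field Ω] [IsAlgClosed Ω] [Algebra B Ω]
    [IsIntegrallyClosedIn B Ω] (p : B[X]) (hp : p.Monic) :
    ∃ s : Multiset B, p = (s.map (fun x => X - C x)).prod := by
  have hinj : Function.Injective (algebraMap B Ω) := (isIntegrallyClosedIn_iff.1 ‹_›).1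
  have h := (IsAlgClosed.splits (p.map (algebraMap B Ω))).eq_prod_roots
  rw [(hp.map _).leadingCoeff, C_1, one_mul] at h
  have : ∀ x ∈ (p.map (algebraMap B Ω)).roots, ∃ y, algebraMap B Ω y = x := fun x hx => by
    refine IsIntegrallyClosedIn.algebraMap_eq_of_integral ⟨p, hp, ?_⟩
    rw [← eval_map]
    exact (mem_roots'.1 hx).2
  choose! g hg using this
  refine ⟨(p.map (algebraMap B Ω)).roots.map g, Polynomial.map_injective _ hinj ?_⟩
  have h2 : ((p.map (algebraMap B Ω)).roots.map g).map (algebraMap B Ω)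
      = (p.map (algebraMap B Ω)).roots := by
    rw [Multiset.map_map]
    exact (Multiset.map_congr rfl hg).trans (Multiset.map_id' _)
  rw [map_prod_X_sub_C, h2]
  exact h

/-! ### Reduction to monic polynomials -/

section Monic

variable {E : Type*} [Field E]

theorem Polynomial.irreducible_scaleRoots_of_isUnit {p : E[X]} (hp : Irreducible p) {r : E}
    (hr : r ≠ 0) : Irreducible (p.scaleRoots r) := by
  have key : ∀ q : E[X], IsUnit (q.scaleRoots r) ↔ IsUnit q := fun q => by
    rw [Polynomial.isUnit_iff_degree_eq_zero, Polynomial.isUnit_iff_degree_eq_zero,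
      degree_scaleRoots]
  refine ⟨fun h => hp.1 ((key _).1 h), fun a b hab => ?_⟩
  have h2 : p = (a.scaleRoots r⁻¹) * (b.scaleRoots r⁻¹) := by
    rw [← mul_scaleRoots_of_noZeroDivisors, ← hab, ← scaleRoots_mul, mul_inv_cancel₀ hr,
      scaleRoots_one]
  have inv : ∀ q : E[X], (q.scaleRoots r⁻¹).scaleRoots r = q := fun q => by
    rw [← scaleRoots_mul, inv_mul_cancel₀ hr, scaleRoots_one]
  rcases hp.2 h2 with h | h
  · left; rw [← inv a]; exact (key _).2 h
  · right; rw [← inv b]; exact (key _).2 h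

/-- Up to the unit given by the leading coefficient, the normalization is a rescaling of the roots,
and rescaling by a nonzero scalar is invertible and multiplicative. -/
theorem Polynomial.irreducible_integralNormalization_iff {p : E[X]} (hp : p ≠ 0) :
    Irreducible p.integralNormalization ↔ Irreducible p := by
  have hc : p.leadingCoeff ≠ 0 := leadingCoeff_ne_zero.2 hp
  have h1 : Irreducible p.integralNormalization ↔ Irreducible (p.scaleRoots p.leadingCoeff) := by
    rw [← leadingCoeff_smul_integralNormalization, smul_eq_C_mul,
      irreducible_isUnit_mul (isUnit_C.2 hc.isUnit)]
  rw [h1]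
  refine ⟨fun h => ?_, fun h => irreducible_scaleRoots_of_isUnit h hc⟩
  have := irreducible_scaleRoots_of_isUnit h (inv_ne_zero hc)
  rwa [← scaleRoots_mul, mul_inv_cancel₀ hc, scaleRoots_one] at this

theorem Polynomial.separable_integralNormalization {p : E[X]} (hp : Irreducible p)
    (hs : p.Separable) : p.integralNormalization.Separable := by
  have hc : p.leadingCoeff ≠ 0 := leadingCoeff_ne_zero.2 hp.ne_zero
  have hi := (irreducible_integralNormalization_iff hp.ne_zero).2 hp
  rw [separable_iff_derivative_ne_zero hi]
  rw [separable_iff_derivative_ne_zero hp] at hs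
  intro h0
  apply hs
  have h1 : derivative (p.scaleRoots p.leadingCoeff) = 0 := by
    rw [← leadingCoeff_smul_integralNormalization, derivative_smul, h0, smul_zero]
  ext i
  have h2 := congrArg (fun q => q.coeff i) h1
  simp only [coeff_derivative, coeff_scaleRoots, coeff_zero] at h2 ⊢
  rw [mul_assoc, mul_comm (_ ^ _), ← mul_assoc] at h2
  exact (mul_eq_zero.1 h2).resolve_right (pow_ne_zero _ hc)

end Monic

/-! ### Clearing denominators and integral primitive elements -/

section Fractions

variable {A B Q Ω : Type*} [CommRing A] [IsDomain A] [CommRing B] [Field Q] [Field Ω]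
  [Algebra A B] [Algebra B Ω] [Algebra A Ω] [Algebra A Q] [Algebra Q Ω] [IsScalarTower A B Ω]
  [IsScalarTower A Q Ω] [IsFractionRing A Q] [Algebra.IsIntegral A B]

theorem exists_smul_eq_of_mem_adjoin (S : Set B) (x : Ω)
    (hx : x ∈ IntermediateField.adjoin Q (algebraMap B Ω '' S)) :
    ∃ d : A, d ≠ 0 ∧ ∃ v ∈ Algebra.adjoin A S, algebraMap B Ω v = d • x := by
  have hint : ∀ s ∈ algebraMap B Ω '' S, IsAlgebraic Q s := by
    rintro _ ⟨s, -, rfl⟩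
    have h : IsIntegral A (algebraMap B Ω s) := (Algebra.IsIntegral.isIntegral (R := A) s).algebraMap
    exact (h.tower_top (A := Q)).isAlgebraic
  rw [← IntermediateField.mem_toSubalgebra,
    IntermediateField.adjoin_toSubalgebra_of_isAlgebraic hint] at hx
  obtain ⟨t, ht⟩ := multiple_mem_adjoin_of_mem_localization_adjoin (nonZeroDivisors A) Q _ _ hx
  have h2 : Algebra.adjoin A (algebraMap B Ω '' S)
      = (Algebra.adjoin A S).map (IsScalarTower.toAlgHom A B Ω) := by
    rw [AlgHom.map_adjoin]; rfl
  rw [h2] at ht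
  obtain ⟨w, hw, hwx⟩ := ht
  exact ⟨t, nonZeroDivisors.ne_zero t.2, w, hw, hwx⟩

variable (Q Ω) in
theorem exists_smul_mem_adjoin_of_mem_adjoin (hB : Function.Injective (algebraMap B Ω))
    (S : Set B) (x : B)
    (hx : algebraMap B Ω x ∈ IntermediateField.adjoin Q (algebraMap B Ω '' S)) :
    ∃ d : A, d ≠ 0 ∧ d • x ∈ Algebra.adjoin A S := by
  obtain ⟨d, hd, v, hv, hvx⟩ := exists_smul_eq_of_mem_adjoin (A := A) S _ hx
  refine ⟨d, hd, ?_⟩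
  have h : v = d • x := hB (by
    rw [hvx, Algebra.smul_def, Algebra.smul_def, map_mul, ← IsScalarTower.algebraMap_apply])
  rwa [← h]

/-- A primitive element of the field becomes an element of `Algebra.adjoin A S` after multiplication
by a nonzero scalar from `A`, which does not change the field it generates. -/
theorem exists_integral_primitive_element (S : Set B) (hS : S.Finite) (hsep : ∀ s ∈ S, IsSeparable Q (algebraMap B Ω s)) :
    ∃ w ∈ Algebra.adjoin A S, IntermediateField.adjoin Q {algebraMap B Ω w}
      = IntermediateField.adjoin Q (algebraMap B Ω '' S) := by
  have hsep' : ∀ s ∈ algebraMap B Ω '' S, IsSeparable Q s := by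
    rintro _ ⟨s, hs, rfl⟩
    exact hsep s hs
  set E := IntermediateField.adjoin Q (algebraMap B Ω '' S) with hE
  have hsepE : Algebra.IsSeparable Q E :=
    (IntermediateField.isSeparable_adjoin_iff_isSeparable Q Ω).2 hsep'
  have : Finite (algebraMap B Ω '' S) := hS.image _
  have hfin : FiniteDimensional Q E :=
    IntermediateField.finiteDimensional_adjoin fun s hs => (hsep' s hs).isIntegral
  obtain ⟨w, hw⟩ := Field.exists_primitive_element Q E
  have hw' : IntermediateField.adjoin Q {(w : Ω)} = E := by
    have := congrArg IntermediateField.lift hw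
    rwa [IntermediateField.lift_adjoin_simple, IntermediateField.lift_top] at this
  obtain ⟨t, ht, v, hv, hvw⟩ := exists_smul_eq_of_mem_adjoin (A := A) S (w : Ω) w.2
  refine ⟨v, hv, ?_⟩
  have ht0 : algebraMap A Q t ≠ 0 :=
    (map_ne_zero_iff _ (IsFractionRing.injective A Q)).2 ht
  have hvw' : algebraMap B Ω v = algebraMap Q Ω (algebraMap A Q t) * w := by
    rw [← IsScalarTower.algebraMap_apply, ← Algebra.smul_def]
    exact hvw
  rw [← hw']
  apply le_antisymm
  · rw [IntermediateField.adjoin_simple_le_iff, hvw']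
    exact mul_mem (IntermediateField.algebraMap_mem _ _) (IntermediateField.mem_adjoin_simple_self _ _)
  · rw [IntermediateField.adjoin_simple_le_iff]
    have : (w : Ω) = algebraMap Q Ω (algebraMap A Q t)⁻¹ * algebraMap B Ω v := by
      rw [hvw', ← mul_assoc, ← map_mul, inv_mul_cancel₀ ht0, map_one, one_mul]
    rw [this]
    exact mul_mem (IntermediateField.algebraMap_mem _ _) (IntermediateField.mem_adjoin_simple_self _ _)

end Fractions

/-! ### Preservation of non-membership under specialization -/

theorem map_mem_adjoin_of_mem_adjoin {A B K k : Type*} [CommRing A] [CommRing B] [Algebra A B]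
    [Field K] [Field k] [Algebra K k] (ev : A →+* K) (φ : B →+* k)
    (hφ : φ.comp (algebraMap A B) = (algebraMap K k).comp ev) (S : Set B) (x : B)
    (hx : x ∈ Algebra.adjoin A S) : φ x ∈ IntermediateField.adjoin K (φ '' S) := by
  induction hx using Algebra.adjoin_induction with
  | mem x hx => exact IntermediateField.subset_adjoin _ _ ⟨x, hx, rfl⟩
  | algebraMap r =>
    rw [show φ (algebraMap A B r) = algebraMap K k (ev r) from congrArg (fun h => h r) hφ]
    exact IntermediateField.algebraMap_mem _ _
  | add x y _ _ hx hy => rw [map_add]; exact add_mem hx hy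
  | mul x y _ _ hx hy => rw [map_mul]; exact mul_mem hx hy

section Specialization

variable {A B Q Ω : Type*} [CommRing A] [IsDomain A] [IsIntegrallyClosed A] [CommRing B] [IsDomain B]
  [Field Q] [Field Ω] [Algebra A B] [Algebra B Ω] [Algebra A Ω] [Algebra A Q] [Algebra Q Ω]
  [IsScalarTower A B Ω] [IsScalarTower A Q Ω] [IsFractionRing A Q] [Algebra.IsIntegral A B]

/-- If `y ∉ Q(S)`, then `φ y ∉ K(φ(S))` for all specializations `φ` that lie above a point at which
a suitable irreducible separable polynomial remains irreducible. -/
theorem exists_irreducible_forall_specialization (hB : Function.Injective (algebraMap B Ω))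
    (S : Set B) (hS : S.Finite) (hsep : ∀ s ∈ S, IsSeparable Q (algebraMap B Ω s)) (y : B)
    (hy : IsSeparable Q (algebraMap B Ω y))
    (hyS : algebraMap B Ω y ∉ IntermediateField.adjoin Q (algebraMap B Ω '' S)) :
    ∃ (F : A[X]) (d : A), F.Monic ∧ Irreducible F ∧ (F.map (algebraMap A Q)).Separable ∧ d ≠ 0 ∧
      ∀ {K : Type*} {k : Type*} [Field K] [Field k] [Algebra K k] (ev : A →+* K) (φ : B →+* k),
        φ.comp (algebraMap A B) = (algebraMap K k).comp ev → ev d ≠ 0 → Irreducible (F.map ev) →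
        φ y ∉ IntermediateField.adjoin K (φ '' S) := by
  have hint : ∀ x : B, IsIntegral A x := Algebra.IsIntegral.isIntegral
  have hsep' : ∀ s ∈ insert y S, IsSeparable Q (algebraMap B Ω s) := by
    rintro s (rfl | hs)
    exacts [hy, hsep s hs]
  obtain ⟨w, hw, hwS⟩ := exists_integral_primitive_element (A := A) S hS hsep
  obtain ⟨z, hz, hzS⟩ := exists_integral_primitive_element (A := A) (insert y S)
    (hS.insert y) hsep'
  have hminQ : ∀ x : B, minpoly Q (algebraMap B Ω x) = (minpoly A x).map (algebraMap A Q) :=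
    fun x => by
      rw [minpoly.isIntegrallyClosed_eq_field_fractions' Q (hint x).algebraMap,
        minpoly.algebraMap_eq hB]
  have hintQ : ∀ x : B, IsIntegral Q (algebraMap B Ω x) := fun x =>
    ((hint x).algebraMap (B := Ω)).tower_top
  -- Here `w` generates Q(S) and `z` generates Q(S, y); since y ∉ Q(S), the degree of `z` is
  -- strictly larger.
  have hlt : (minpoly A w).natDegree < (minpoly A z).natDegree := by
    have h1 : ∀ x : B, (minpoly A x).natDegree
        = Module.finrank Q (IntermediateField.adjoin Q {algebraMap B Ω x}) := fun x => by
      rw [IntermediateField.adjoin.finrank (hintQ x), hminQ, (minpoly.monic (hint x)).natDegree_map]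
    have : FiniteDimensional Q (IntermediateField.adjoin Q {algebraMap B Ω z}) :=
      IntermediateField.adjoin.finiteDimensional (hintQ z)
    rw [h1, h1]
    by_contra! hle
    have hle' : IntermediateField.adjoin Q {algebraMap B Ω w}
        ≤ IntermediateField.adjoin Q {algebraMap B Ω z} := by
      rw [hwS, hzS]
      exact IntermediateField.adjoin.mono _ _ _ (Set.image_mono (Set.subset_insert _ _))
    have heq := IntermediateField.eq_of_le_of_finrank_le hle' hle
    rw [hwS, hzS] at heq
    apply hyS
    rw [heq]
    exact IntermediateField.subset_adjoin _ _ ⟨y, Set.mem_insert _ _, rfl⟩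
  have hden : ∀ s ∈ S, ∃ d : A, d ≠ 0 ∧ d • s ∈ Algebra.adjoin A {w} := fun s hs => by
    apply exists_smul_mem_adjoin_of_mem_adjoin Q Ω hB
    rw [Set.image_singleton, hwS]
    exact IntermediateField.subset_adjoin _ _ ⟨s, hs, rfl⟩
  choose! d hd0 hd using hden
  -- Irreducibility of the specialized minimal polynomial of `z` keeps the degree of φ(z) full; the
  -- product of denominators keeps φ(S) inside K(φ(w)).
  refine ⟨minpoly A z, ∏ s ∈ hS.toFinset, d s, minpoly.monic (hint z), minpoly.irreducible (hint z),
    ?_, Finset.prod_ne_zero_iff.2 fun s hs => hd0 s (hS.mem_toFinset.1 hs), ?_⟩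
  · rw [← hminQ]
    have : Algebra.IsSeparable Q (IntermediateField.adjoin Q (algebraMap B Ω '' insert y S)) := by
      rw [IntermediateField.isSeparable_adjoin_iff_isSeparable]
      rintro _ ⟨s, hs, rfl⟩
      exact hsep' s hs
    apply IntermediateField.isSeparable_of_mem_isSeparable Q Ω
      (L := IntermediateField.adjoin Q (algebraMap B Ω '' insert y S))
    rw [← hzS]
    exact IntermediateField.mem_adjoin_simple_self _ _
  · intro K k _ _ _ ev φ hφ hev hirr hmem
    have hφ' : ∀ a, φ (algebraMap A B a) = algebraMap K k (ev a) := fun a =>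
      congrArg (fun h => h a) hφ
    have hroot : ∀ x : B, aeval (φ x) ((minpoly A x).map ev) = 0 := fun x => by
      rw [aeval_def, eval₂_map, ← hφ, ← hom_eval₂, ← aeval_def, minpoly.aeval, map_zero]
    have hintK : ∀ x : B, IsIntegral K (φ x) := fun x =>
      ⟨_, (minpoly.monic (hint x)).map ev, hroot x⟩
    have hS' : IntermediateField.adjoin K (φ '' S) ≤ IntermediateField.adjoin K {φ w} := by
      rw [IntermediateField.adjoin_le_iff]
      rintro _ ⟨s, hs, rfl⟩
      have h1 := map_mem_adjoin_of_mem_adjoin ev φ hφ _ _ (hd s hs)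
      rw [Set.image_singleton, Algebra.smul_def, map_mul, hφ'] at h1
      have h0 : ev (d s) ≠ 0 := by
        rw [map_prod, Finset.prod_ne_zero_iff] at hev
        exact hev s (hS.mem_toFinset.2 hs)
      have h2 : φ s = algebraMap K k (ev (d s))⁻¹ * (algebraMap K k (ev (d s)) * φ s) := by
        rw [← mul_assoc, ← map_mul, inv_mul_cancel₀ h0, map_one, one_mul]
      rw [h2]
      exact mul_mem (IntermediateField.algebraMap_mem _ _) h1
    have hzw : IntermediateField.adjoin K {φ z} ≤ IntermediateField.adjoin K {φ w} := by
      rw [IntermediateField.adjoin_simple_le_iff]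
      have h1 := map_mem_adjoin_of_mem_adjoin ev φ hφ _ _ hz
      refine IntermediateField.adjoin_le_iff.2 ?_ h1
      rintro _ ⟨s, rfl | hs, rfl⟩
      · exact hS' hmem
      · exact hS' (IntermediateField.subset_adjoin _ _ ⟨s, hs, rfl⟩)
    have : FiniteDimensional K (IntermediateField.adjoin K {φ w}) :=
      IntermediateField.adjoin.finiteDimensional (hintK w)
    -- If φ(y) were in K(φ(S)), then deg z = deg φ(z) ≤ deg φ(w) ≤ deg w, against `hlt`.
    have h1 := IntermediateField.finrank_le_of_le_right hzw
    rw [IntermediateField.adjoin.finrank (hintK z), IntermediateField.adjoin.finrank (hintK w),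
      ← minpoly.eq_of_irreducible_of_monic hirr (hroot z) ((minpoly.monic (hint z)).map ev),
      (minpoly.monic (hint z)).natDegree_map] at h1
    have h2 := natDegree_le_natDegree
      (minpoly.min K (φ w) ((minpoly.monic (hint w)).map ev) (hroot w))
    rw [(minpoly.monic (hint w)).natDegree_map] at h2
    omega

end Specialization

theorem IsHilbertian.exists_eval_irreducible {K : Type*} [Field K] (hK : IsHilbertian K)
    {σ J : Type*} [Finite σ] [Finite J] (F : J → (MvPolynomial σ K)[X]) (g : MvPolynomial σ K)
    (hg : g ≠ 0) (hF : ∀ j, (F j).Monic) (hirr : ∀ j, Irreducible (F j))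
    (hsep : ∀ j, ((F j).map (algebraMap (MvPolynomial σ K)
      (FractionRing (MvPolynomial σ K)))).Separable) :
    ∃ b : σ → K, MvPolynomial.eval b g ≠ 0 ∧
      ∀ j, Irreducible ((F j).map (MvPolynomial.eval b)) := by
  obtain ⟨r, ⟨e⟩⟩ := Finite.exists_equiv_fin σ
  obtain ⟨m, ⟨e'⟩⟩ := Finite.exists_equiv_fin J
  let ρ : MvPolynomial σ K ≃+* MvPolynomial (Fin r) K := (MvPolynomial.renameEquiv K e).toRingEquiv
  let f : Fin m → (MvPolynomial (Fin r) K)[X] := fun i => (F (e'.symm i)).map (ρ : _ →+* _)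
  have hf : ∀ i, (f i).Monic := fun i => (hF _).map _
  have hfirr : ∀ i, Irreducible (f i) := fun i =>
    (MulEquiv.irreducible_iff (Polynomial.mapEquiv ρ)).2 (hirr (e'.symm i))
  obtain ⟨a, ha, hai⟩ := hK r m f (ρ g) (by simpa using hg)
    (fun i => ((hf i).irreducible_iff_irreducible_map_fraction_map).1 (hfirr i)) (fun i => by
      let θ : FractionRing (MvPolynomial σ K) →+* FractionRing (MvPolynomial (Fin r) K) :=
        IsFractionRing.map (A := MvPolynomial σ K)
          (show Function.Injective (ρ : MvPolynomial σ K →+* MvPolynomial (Fin r) K) from ρ.injective)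
      have h := (hsep (e'.symm i)).map (f := θ)
      rw [Polynomial.map_map] at h ⊢
      rwa [show θ.comp (algebraMap (MvPolynomial σ K) (FractionRing (MvPolynomial σ K)))
        = (algebraMap _ _).comp (ρ : MvPolynomial σ K →+* MvPolynomial (Fin r) K) from
        IsLocalization.map_comp _] at h)
  have hev : ∀ p, MvPolynomial.eval a (ρ p) = MvPolynomial.eval (a ∘ e) p := fun p =>
    MvPolynomial.eval_rename _ _ _
  refine ⟨a ∘ e, by rwa [← hev], fun j => ?_⟩
  have h := hai (e' j)
  rw [Polynomial.map_map] at h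
  convert h using 2
  · exact RingHom.ext fun p => (hev p).symm
  · rw [e'.symm_apply_apply]

/-- Each index contributes one irreducible polynomial and one denominator, and a single Hilbert set
handles them all. The point `b` serves every `φ` above it, so `φ` can be chosen later with
prescribed values on a larger ring of constants. -/
theorem IsHilbertian.exists_specialization_notMem {K : Type*} [Field K] (hK : IsHilbertian K)
    {σ J B Ω : Type*} [Finite σ] [Finite J] [CommRing B] [IsDomain B] [Field Ω]
    [Algebra (MvPolynomial σ K) B] [Algebra B Ω] [Algebra (MvPolynomial σ K) Ω]
    [Algebra (FractionRing (MvPolynomial σ K)) Ω] [IsScalarTower (MvPolynomial σ K) B Ω]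
    [IsScalarTower (MvPolynomial σ K) (FractionRing (MvPolynomial σ K)) Ω]
    [Algebra.IsIntegral (MvPolynomial σ K) B] (hB : Function.Injective (algebraMap B Ω))
    (S : J → Set B) (hS : ∀ j, (S j).Finite)
    (hsep : ∀ j, ∀ s ∈ S j, IsSeparable (FractionRing (MvPolynomial σ K)) (algebraMap B Ω s))
    (y : J → B) (hy : ∀ j, IsSeparable (FractionRing (MvPolynomial σ K)) (algebraMap B Ω (y j)))
    (hyS : ∀ j, algebraMap B Ω (y j) ∉
      IntermediateField.adjoin (FractionRing (MvPolynomial σ K)) (algebraMap B Ω '' S j))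
    (g : MvPolynomial σ K) (hg : g ≠ 0) (k : Type*) [Field k] [Algebra K k] :
    ∃ b : σ → K, MvPolynomial.eval b g ≠ 0 ∧ ∀ φ : B →+* k,
      φ.comp (algebraMap (MvPolynomial σ K) B) = (algebraMap K k).comp (MvPolynomial.eval b) →
      ∀ j, φ (y j) ∉ IntermediateField.adjoin K (φ '' S j) := by
  have := Fintype.ofFinite J
  choose F d hFm hFi hFs hd h using fun j =>
    exists_irreducible_forall_specialization (A := MvPolynomial σ K)
      (Q := FractionRing (MvPolynomial σ K)) hB (S j) (hS j) (hsep j) (y j) (hy j) (hyS j)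
  obtain ⟨b, hb, hbi⟩ := hK.exists_eval_irreducible F (g * ∏ j, d j)
    (mul_ne_zero hg (Finset.prod_ne_zero_iff.2 fun j _ => hd j)) hFm hFi hFs
  rw [map_mul, map_prod] at hb
  exact ⟨b, left_ne_zero_of_mul hb, fun φ hφ j => h j _ φ hφ
    (Finset.prod_ne_zero_iff.1 (right_ne_zero_of_mul hb) j (Finset.mem_univ j)) (hbi j)⟩

/-! ### Avoiding subspaces, and the pencil substitution -/

/-- A polynomial over `k` with a coefficient outside the `K`-subspace `W` takes values outside `W`
at all `K`-rational points off a hypersurface defined over `K`. -/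
theorem MvPolynomial.exists_forall_eval_notMem {K k σ : Type*} [Field K] [Field k] [Algebra K k]
    (W : Submodule K k) (y : MvPolynomial σ k) (m : σ →₀ ℕ) (hm : y.coeff m ∉ W) :
    ∃ g : MvPolynomial σ K, g ≠ 0 ∧ ∀ b : σ → K, MvPolynomial.eval b g ≠ 0 →
      MvPolynomial.eval (algebraMap K k ∘ b) y ∉ W := by
  classical
  -- Applying a `K`-linear functional that kills `W` to the coefficients of `y` gives the
  -- hypersurface, because the functional commutes with evaluation at `K`-rational points.
  obtain ⟨f, hf, hfW⟩ := Submodule.exists_le_ker_of_notMem hm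
  have hms : m ∈ y.support := MvPolynomial.mem_support_iff.2 fun h => hm (h ▸ W.zero_mem)
  refine ⟨∑ n ∈ y.support, MvPolynomial.monomial n (f (y.coeff n)), ?_, ?_⟩
  · intro h
    apply hf
    have := congrArg (MvPolynomial.coeff m) h
    rw [MvPolynomial.coeff_sum] at this
    rw [Finset.sum_eq_single m (fun n _ hn => by rw [MvPolynomial.coeff_monomial, if_neg hn])
      (fun h => absurd hms h), MvPolynomial.coeff_monomial, if_pos rfl] at this
    exact this
  · intro b hb hW
    apply hb
    have h1 : f (MvPolynomial.eval (algebraMap K k ∘ b) y) = 0 := hfW hW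
    rw [← h1, MvPolynomial.eval_eq (algebraMap K k ∘ b) y, map_sum, map_sum]
    refine Finset.sum_congr rfl fun n _ => ?_
    rw [MvPolynomial.eval_monomial]
    have h2 : ∏ i ∈ n.support, (algebraMap K k ∘ b) i ^ n i
        = algebraMap K k (n.prod fun i e => b i ^ e) := by
      simp [Finsupp.prod]
    rw [h2, mul_comm (y.coeff n), ← Algebra.smul_def, map_smul, smul_eq_mul, mul_comm]

/-- The substitution `T_i ↦ t_i + α t'_i`. -/
noncomputable def pencil {A : Type*} [CommRing A] (ι : Type*) (α : A) :
    MvPolynomial ι A →ₐ[A] MvPolynomial (ι ⊕ ι) A :=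
  MvPolynomial.aeval fun i =>
    MvPolynomial.X (Sum.inl i) + MvPolynomial.C α * MvPolynomial.X (Sum.inr i)

theorem map_pencil {A A' ι : Type*} [CommRing A] [CommRing A'] (f : A →+* A') (α : A)
    (p : MvPolynomial ι A) :
    MvPolynomial.map f (pencil ι α p) = pencil ι (f α) (MvPolynomial.map f p) := by
  induction p using MvPolynomial.induction_on with
  | C a => simp [pencil]
  | add p q hp hq => simp [hp, hq]
  | mul_X p i hp =>
    rw [map_mul, map_mul, hp, map_mul, map_mul]
    simp [pencil]

theorem pencil_injective {A : Type*} [CommRing A] (ι : Type*) (α : A) :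
    Function.Injective (pencil ι α) := by
  have h : (MvPolynomial.aeval (Sum.elim MvPolynomial.X 0)).comp (pencil ι α)
      = AlgHom.id A (MvPolynomial ι A) := by
    apply MvPolynomial.algHom_ext
    intro i
    simp [pencil]
  exact Function.LeftInverse.injective
    (g := MvPolynomial.aeval (R := A) (Sum.elim MvPolynomial.X 0)) fun p => congrArg (fun f => f p) h

theorem eval_pencil {A ι : Type*} [CommRing A] (α : A) (p : MvPolynomial ι A) (b : ι ⊕ ι → A) :
    MvPolynomial.eval b (pencil ι α p)
      = MvPolynomial.eval (fun i => b (Sum.inl i) + α * b (Sum.inr i)) p := by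
  induction p using MvPolynomial.induction_on with
  | C a => simp [pencil]
  | add p q hp hq => simp [hp, hq]
  | mul_X p i hp =>
    rw [map_mul, map_mul, hp, map_mul]
    simp [pencil]

theorem IsAlgClosed.mem_range_of_isIntegralElem {k Ω : Type*} [Field k] [IsAlgClosed k] [Field Ω]
    (f : k →+* Ω) (z : Ω) (hz : f.IsIntegralElem z) : z ∈ f.range := by
  obtain ⟨q, hq, hqz⟩ := hz
  have h := (IsAlgClosed.splits q).eq_prod_roots
  rw [hq.leadingCoeff, C_1, one_mul] at h
  rw [h, ← eval_map, map_prod_X_sub_C, eval_multiset_prod, Multiset.prod_eq_zero_iff,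
    Multiset.map_map, Multiset.map_map] at hqz
  obtain ⟨a, -, ha⟩ := Multiset.mem_map.1 hqz
  exact ⟨a, by simpa [sub_eq_zero, eq_comm (a := (0 : Ω)), eq_comm (a := z)] using ha⟩

/-! ### Independence of two pencils -/

section Disjointness

variable {k ι : Type*} [Field k]

/-- This is restriction to the affine subspace t + α't' = v, on which T = t + αt' serves as
coordinates because α ≠ α'. Taking v from a point where `d` does not vanish keeps `d` nonzero on the
subspace. -/
theorem exists_retraction_pencil [Infinite k] {α α' : k} (hne : α ≠ α')
    {d : MvPolynomial (ι ⊕ ι) k} (hd : d ≠ 0) :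
    ∃ (v : ι → k) (ψ : MvPolynomial (ι ⊕ ι) k →ₐ[k] MvPolynomial ι k), ψ d ≠ 0 ∧
      (∀ p, ψ (pencil ι α p) = p) ∧
      ∀ p, ψ (pencil ι α' p) = MvPolynomial.C (MvPolynomial.eval v p) := by
  obtain ⟨t, ht⟩ : ∃ t, MvPolynomial.eval t d ≠ 0 := by
    by_contra! h
    exact hd (MvPolynomial.funext fun t => by rw [h t, map_zero])
  have hs : α - α' ≠ 0 := sub_ne_zero.2 hne
  let v : ι → k := fun i => t (Sum.inl i) + α' * t (Sum.inr i)
  -- The value of t' obtained by solving t + αt' = T and t + α't' = v.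
  let e : ι → MvPolynomial ι k := fun i =>
    MvPolynomial.C (α - α')⁻¹ * (MvPolynomial.X i - MvPolynomial.C (v i))
  let ψ : MvPolynomial (ι ⊕ ι) k →ₐ[k] MvPolynomial ι k :=
    MvPolynomial.aeval (Sum.elim (fun i => MvPolynomial.X i - MvPolynomial.C α * e i) e)
  refine ⟨v, ψ, ?_, ?_, ?_⟩
  · intro h0
    apply ht
    -- The coordinates of the chosen point `t` on the subspace: evaluating at `T` after `ψ` is
    -- evaluating at `t`.
    let T : ι → k := fun i => t (Sum.inl i) + α * t (Sum.inr i)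
    have hTe : ∀ i, MvPolynomial.eval T (e i) = t (Sum.inr i) := fun i => by
      simp only [e, map_mul, map_sub, MvPolynomial.eval_C, MvPolynomial.eval_X, T, v]
      field_simp
      ring
    have h1 : (MvPolynomial.aeval (R := k) T).comp ψ = MvPolynomial.aeval t := by
      apply MvPolynomial.algHom_ext
      rintro (i | i)
      · have h : MvPolynomial.aeval T (e i) = t (Sum.inr i) := hTe i
        simp only [ψ, AlgHom.comp_apply, MvPolynomial.aeval_X, Sum.elim_inl, map_sub, map_mul, h,
          MvPolynomial.aeval_C, Algebra.algebraMap_self, RingHom.id_apply]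
        simp [T]
      · have h : MvPolynomial.aeval T (e i) = t (Sum.inr i) := hTe i
        simp only [ψ, AlgHom.comp_apply, MvPolynomial.aeval_X, Sum.elim_inr, h]
    have h2 := congrArg (fun f => f d) h1
    simp only [AlgHom.comp_apply, h0, map_zero] at h2
    exact h2.symm
  · have h1 : ψ.comp (pencil ι α) = AlgHom.id k _ := by
      apply MvPolynomial.algHom_ext
      intro i
      simp [ψ, pencil, MvPolynomial.algHom_C]
    exact fun p => congrArg (fun f => f p) h1
  · have h1 : ψ.comp (pencil ι α') = (Algebra.ofId k _).comp (MvPolynomial.aeval v) := by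
      apply MvPolynomial.algHom_ext
      intro i
      have h2 : MvPolynomial.C α * e i - MvPolynomial.C α' * e i
          = MvPolynomial.X i - MvPolynomial.C (v i) := by
        rw [← sub_mul, ← map_sub, ← mul_assoc, ← map_mul, mul_inv_cancel₀ hs, map_one, one_mul]
      have h3 : (Algebra.ofId k (MvPolynomial ι k)) (v i) = MvPolynomial.C (v i) := rfl
      simp only [ψ, pencil, AlgHom.comp_apply, MvPolynomial.aeval_X, map_add, map_mul,
        Sum.elim_inl, Sum.elim_inr, h3, MvPolynomial.algHom_C, MvPolynomial.algebraMap_eq]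
      linear_combination -h2
    exact fun p => congrArg (fun f => f p) h1

/-- An element integral over `k[t + α t']` that lies in the compositum of `k(t, t')` with fields
algebraic over `k(t + α' t')` is a polynomial. -/
theorem mem_range_of_smul_mem_adjoin [IsAlgClosed k] {B : Type*} [CommRing B] [IsDomain B]
    [Algebra (MvPolynomial (ι ⊕ ι) k) B] [Algebra.IsIntegral (MvPolynomial (ι ⊕ ι) k) B]
    (hB : Function.Injective (algebraMap (MvPolynomial (ι ⊕ ι) k) B)) {α α' : k} (hne : α ≠ α')
    (y : B) (hy : ((algebraMap (MvPolynomial (ι ⊕ ι) k) B).comp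
      (pencil ι α).toRingHom).IsIntegralElem y) (S : Set B)
    (hS : ∀ s ∈ S, ((algebraMap (MvPolynomial (ι ⊕ ι) k) B).comp
      (pencil ι α').toRingHom).IsIntegralElem s)
    (d : MvPolynomial (ι ⊕ ι) k) (hd : d ≠ 0)
    (hdy : d • y ∈ Algebra.adjoin (MvPolynomial (ι ⊕ ι) k) S) :
    y ∈ (algebraMap (MvPolynomial (ι ⊕ ι) k) B).range := by
  have : Infinite k := IsAlgClosed.instInfinite
  obtain ⟨v, ψ, hψd, hψα, hψα'⟩ := exists_retraction_pencil hne hd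
  let A := MvPolynomial ι k
  let F := FractionRing A
  let Ω := AlgebraicClosure F
  let j : A →+* Ω := (algebraMap F Ω).comp (algebraMap A F)
  have hj : Function.Injective j :=
    (algebraMap F Ω).injective.comp (IsFractionRing.injective A F)
  obtain ⟨Ψ, hΨ⟩ := exists_ringHom_extension hB (j.comp ψ.toRingHom)
  have hΨ' : ∀ r, Ψ (algebraMap _ B r) = j (ψ r) := fun r => congrArg (fun h => h r) hΨ
  -- Under `Ψ` the second pencil becomes constant, so elements integral over it become algebraic
  -- over `k`, hence lie in `k`.
  have hSr : ∀ s ∈ S, Ψ s ∈ j.range := fun s hs => by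
    obtain ⟨q, hq, hqs⟩ := hS s hs
    have h1 : (j.comp MvPolynomial.C).IsIntegralElem (Ψ s) := by
      refine ⟨q.map (MvPolynomial.eval v), hq.map _, ?_⟩
      have h2 := congrArg Ψ hqs
      rw [hom_eval₂, map_zero] at h2
      rw [eval₂_map, ← h2]
      congr 1
      refine RingHom.ext fun p => ?_
      change _ = Ψ (algebraMap _ B (pencil ι α' p))
      rw [hΨ', hψα']
      rfl
    obtain ⟨a, ha⟩ := IsAlgClosed.mem_range_of_isIntegralElem _ _ h1
    exact ⟨_, ha⟩
  have hadj : ∀ x ∈ Algebra.adjoin (MvPolynomial (ι ⊕ ι) k) S, Ψ x ∈ j.range := fun x hx => by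
    induction hx using Algebra.adjoin_induction with
    | mem x hx => exact hSr x hx
    | algebraMap r => exact ⟨ψ r, (hΨ' r).symm⟩
    | add x y _ _ hx hy => rw [map_add]; exact add_mem hx hy
    | mul x y _ _ hx hy => rw [map_mul]; exact mul_mem hx hy
  obtain ⟨c, hc⟩ := hadj _ hdy
  rw [Algebra.smul_def, map_mul, hΨ'] at hc
  let i : A →+* B := (algebraMap (MvPolynomial (ι ⊕ ι) k) B).comp (pencil ι α).toRingHom
  let _ : Algebra A B := i.toAlgebra
  have hyA : IsIntegral A y := hy
  have hΨi : Ψ.comp i = j := by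
    refine RingHom.ext fun p => ?_
    change Ψ (algebraMap _ B (pencil ι α p)) = _
    rw [hΨ', hψα]
  have hroot : eval₂ j (Ψ y) (minpoly A y) = 0 := by
    rw [← hΨi, ← hom_eval₂]
    exact (congrArg Ψ (minpoly.aeval A y)).trans (map_zero _)
  let z : F := algebraMap A F c / algebraMap A F (ψ d)
  have hz : algebraMap F Ω z = Ψ y := by
    have h0 : j (ψ d) ≠ 0 := (map_ne_zero_iff _ hj).2 hψd
    rw [map_div₀]
    change j c / j (ψ d) = _
    rw [hc, mul_div_cancel_left₀ _ h0]
  -- Ψ(y) is a fraction and integral over the polynomial ring `A`, which is integrally closed, so it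
  -- is a polynomial.
  obtain ⟨e, he⟩ : ∃ e, algebraMap A F e = z := by
    refine IsIntegrallyClosed.isIntegral_iff.1 ⟨minpoly A y, minpoly.monic hyA, ?_⟩
    apply (algebraMap F Ω).injective
    rw [hom_eval₂, hz, map_zero]
    exact hroot
  have hje : j e = Ψ y := by rw [← hz, ← he]; rfl
  have he0 : (minpoly A y).IsRoot e := by
    apply hj
    rw [← hje, eval₂_hom] at hroot
    rw [hroot, map_zero]
  -- The minimal polynomial of `y` over `A` is irreducible with a root `e` in `A`, hence linear;
  -- thus `y` is itself the pullback of `e`.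
  obtain ⟨q, hq⟩ := dvd_iff_isRoot.2 he0
  have hqu : IsUnit q := ((minpoly.irreducible hyA).isUnit_or_isUnit hq).resolve_left
    (not_isUnit_X_sub_C e)
  have h1 := minpoly.aeval A y
  rw [hq, map_mul] at h1
  have h2 := (mul_eq_zero.1 h1).resolve_right (hqu.map (aeval y)).ne_zero
  rw [map_sub, aeval_X, aeval_C, sub_eq_zero] at h2
  exact ⟨pencil ι α e, h2.symm⟩

end Disjointness

/-! ### Separability of the roots, and factors over L -/

theorem isSeparable_of_isRoot_of_coeff_mem_separableClosure {Q Ω : Type*} [Field Q] [Field Ω]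
    [Algebra Q Ω] (f : Polynomial Ω) (hf : f.Separable) (hc : ∀ n, f.coeff n ∈ separableClosure Q Ω)
    (x : Ω) (hx : f.IsRoot x) : IsSeparable Q x := by
  obtain ⟨g, rfl⟩ : ∃ g : (separableClosure Q Ω)[X], g.map (algebraMap _ Ω) = f := by
    rw [← mem_lifts, lifts_iff_coeff_lifts]
    exact fun n => ⟨⟨_, hc n⟩, rfl⟩
  rw [separable_map] at hf
  have h1 : aeval x g = 0 := by rwa [IsRoot, eval_map_algebraMap] at hx
  have h2 : IsSeparable (separableClosure Q Ω) x := hf.of_dvd (minpoly.dvd _ _ h1)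
  exact IsSeparable.of_algebra_isSeparable_of_isSeparable Q h2

/-- Constants from `L` are separable over `K`, and the variables already come from `Q`. -/
theorem ringHom_mem_separableClosure {K L Q Ω σ : Type*} [Field K] [Field L] [Algebra K L]
    [Algebra.IsSeparable K L] [Field Q] [Field Ω] [Algebra Q Ω] [Algebra (MvPolynomial σ K) Q]
    (θ : MvPolynomial σ L →+* Ω)
    (hθ : ∀ p, θ (MvPolynomial.map (algebraMap K L) p)
      = algebraMap Q Ω (algebraMap (MvPolynomial σ K) Q p)) (p : MvPolynomial σ L) :
    θ p ∈ separableClosure Q Ω := by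
  induction p using MvPolynomial.induction_on with
  | C a =>
    rw [mem_separableClosure_iff]
    have h1 : ((minpoly K a).map ((algebraMap (MvPolynomial σ K) Q).comp MvPolynomial.C)).Separable :=
      Separable.map (Algebra.IsSeparable.isSeparable K a : (minpoly K a).Separable)
    refine h1.of_dvd (minpoly.dvd _ _ ?_)
    have h2 : (algebraMap Q Ω).comp ((algebraMap (MvPolynomial σ K) Q).comp MvPolynomial.C)
        = (θ.comp MvPolynomial.C).comp (algebraMap K L) := by
      ext c
      have := hθ (MvPolynomial.C c)
      rw [MvPolynomial.map_C] at this
      exact this.symm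
    rw [aeval_def, eval₂_map, h2]
    have h3 := congrArg (θ.comp MvPolynomial.C) (minpoly.aeval K a)
    rwa [aeval_def, hom_eval₂, map_zero] at h3
  | add p q hp hq => rw [map_add]; exact add_mem hp hq
  | mul_X p i hp =>
    rw [map_mul]
    refine mul_mem hp ?_
    have := hθ (MvPolynomial.X i)
    rw [MvPolynomial.map_X] at this
    rw [this]
    exact (separableClosure Q Ω).algebraMap_mem _

/-- If `f` is irreducible over `L`, then the product of a proper nonempty set of linear factors
of its pullback along a pencil has a coefficient that is not a polynomial over `L`. -/
theorem exists_coeff_prod_notMem_range {L ι B : Type*} [Field L] [CommRing B] [IsDomain B]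
    (i : MvPolynomial (ι ⊕ ι) L →+* B) (hi : Function.Injective i) (α : L)
    (f : (MvPolynomial ι L)[X]) (hf : f.Monic) (hirr : Irreducible f) (s : Multiset B)
    (hs : f.map (i.comp (pencil ι α).toRingHom) = (s.map fun x => X - C x).prod)
    (S : Multiset B) (hSs : S ≤ s) (h0 : 0 < S.card) (hlt : S.card < s.card) :
    ∃ j, (S.map fun x => X - C x).prod.coeff j ∉ i.range := by
  by_contra! hall
  obtain ⟨H, hH⟩ : ∃ H : (MvPolynomial (ι ⊕ ι) L)[X],
      H.map i = (S.map fun x => X - C x).prod := by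
    rw [← mem_lifts, lifts_iff_coeff_lifts]
    exact hall
  have hHm : H.Monic := (Function.Injective.monic_map_iff hi).2 (hH ▸ monic_prod_X_sub_C S)
  have hHd : H.natDegree = S.card := by
    rw [← natDegree_prod_X_sub_C S, ← hH, hHm.natDegree_map]
  have hfd : f.natDegree = s.card := by
    rw [← natDegree_prod_X_sub_C s, ← hs, hf.natDegree_map]
  have hdvd : H ∣ f.map (pencil ι α).toRingHom := by
    rw [← Polynomial.map_dvd_map i hi hHm, hH, Polynomial.map_map, hs]
    exact Multiset.prod_dvd_prod_of_le (Multiset.map_le_map hSs)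
  -- Setting t' = 0 undoes the pencil and turns the factor `H` of the pullback into a factor of `f`
  -- of the same degree.
  let ρ : MvPolynomial (ι ⊕ ι) L →ₐ[L] MvPolynomial ι L :=
    MvPolynomial.aeval (Sum.elim MvPolynomial.X 0)
  have hρ : ρ.toRingHom.comp (pencil ι α).toRingHom = RingHom.id _ := by
    have h : ρ.comp (pencil ι α) = AlgHom.id L (MvPolynomial ι L) := by
      apply MvPolynomial.algHom_ext
      intro i
      simp [ρ, pencil]
    exact congrArg AlgHom.toRingHom h
  have hdvd' : H.map ρ.toRingHom ∣ f := by
    have := Polynomial.map_dvd ρ.toRingHom hdvd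
    rwa [Polynomial.map_map, hρ, Polynomial.map_id] at this
  obtain ⟨q, hq⟩ := hdvd'
  have hHρ : (H.map ρ.toRingHom).Monic := hHm.map _
  have hqm : q.Monic := hHρ.of_mul_monic_left (hq ▸ hf)
  have hdeg := congrArg natDegree hq
  rw [hHρ.natDegree_mul hqm, hHm.natDegree_map, hHd, hfd] at hdeg
  rcases hirr.isUnit_or_isUnit hq with hu | hu
  · have := congrArg natDegree (hHρ.eq_one_of_isUnit hu)
    rw [hHm.natDegree_map, natDegree_one] at this
    omega
  · have := congrArg natDegree (hqm.eq_one_of_isUnit hu)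
    rw [natDegree_one] at this
    omega

/-- An element of `L` outside `M` is moved by an automorphism fixing `L ∩ M`. -/
theorem exists_gal_apply_ne_of_notMem {K L k : Type*} [Field K] [Field L] [Field k] [Algebra K L]
    [Algebra L k] [Algebra K k] [IsScalarTower K L k] [IsGalois K L] (M : IntermediateField K k)
    (y : L) (hy : algebraMap L k y ∉ M) :
    ∃ g : Gal(L/K), g y ≠ y ∧ ∀ x : L, algebraMap L k x ∈ M → g x = x := by
  let M' : IntermediateField K L := M.comap (IsScalarTower.toAlgHom K L k)
  have hy' : y ∉ M' := hy
  rw [← InfiniteGalois.fixedField_fixingSubgroup M', IntermediateField.mem_fixedField_iff] at hy'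
  push Not at hy'
  obtain ⟨g, hg, hgy⟩ := hy'
  exact ⟨g, hgy, fun x hx => (IntermediateField.mem_fixingSubgroup_iff _ _).1 hg x hx⟩

theorem MvPolynomial.eval_comp_map {A A' σ : Type*} [CommRing A] [CommRing A'] (f : A →+* A')
    (b : σ → A) (p : MvPolynomial σ A) :
    MvPolynomial.eval (f ∘ b) (MvPolynomial.map f p) = f (MvPolynomial.eval b p) := by
  rw [MvPolynomial.eval_map, ← MvPolynomial.eval₂_id (g := b), MvPolynomial.eval₂_comp_left f]
  simp

/-! ### Irreducible specializations over L -/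

/-- Irreducibility of `f(a, X)` over `L` at `a = b₀ + α b₁`, read off from a specialization `φ`
above `b`. Here `σ` is an automorphism of `L` that commutes with all automorphisms fixing the
constants in `Y`. -/
theorem irreducible_map_eval_of_specialization {K L k B ι : Type*} [Field K] [Field L] [Field k]
    [Algebra K L] [Algebra L k] [Algebra K k] [IsScalarTower K L k] [IsGalois K L] [IsAlgClosed k]
    [CommRing B] (i : MvPolynomial (ι ⊕ ι) L →+* B) (φ : B →+* k) (b : ι ⊕ ι → K)
    (hφ : ∀ p, φ (i p) = algebraMap L k (MvPolynomial.eval (algebraMap K L ∘ b) p))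
    (σ : Gal(L/K)) (Y : Set B)
    (hY : ∀ g : Gal(L/K), (∀ x : L, i (MvPolynomial.C x) ∈ Y → g x = x) →
      ∀ x, g (σ x) = σ (g x))
    (α : L) (f : (MvPolynomial ι L)[X]) (hf : f.Monic) (hpos : f.natDegree ≠ 0) (s s' : Multiset B)
    (hs : f.map (i.comp (pencil ι α).toRingHom) = (s.map fun x => X - C x).prod)
    (hs' : (f.map (MvPolynomial.map (σ : L →+* L))).map (i.comp (pencil ι (σ α)).toRingHom)
      = (s'.map fun x => X - C x).prod)
    (h : ∀ S ≤ s, 0 < S.card → S.card < s.card → ∃ j,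
      φ ((S.map fun x => X - C x).prod.coeff j) ∉ (algebraMap L k).range ∨
      φ ((S.map fun x => X - C x).prod.coeff j) ∉
        IntermediateField.adjoin K (φ '' ({x | x ∈ s'} ∪ Y))) :
    Irreducible (f.map (MvPolynomial.eval
      fun t => algebraMap K L (b (Sum.inl t)) + α * algebraMap K L (b (Sum.inr t)))) := by
  have : Nontrivial B := φ.domain_nontrivial
  have key : ∀ β : L, (algebraMap L k).comp (MvPolynomial.eval
      fun t => algebraMap K L (b (Sum.inl t)) + β * algebraMap K L (b (Sum.inr t)))
      = φ.comp (i.comp (pencil ι β).toRingHom) := fun β => by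
    refine RingHom.ext fun p => ?_
    change _ = φ (i (pencil ι β p))
    rw [hφ, eval_pencil]
    rfl
  set a : ι → L := fun t => algebraMap K L (b (Sum.inl t)) + α * algebraMap K L (b (Sum.inr t))
    with ha
  have hfa : (f.map (MvPolynomial.eval a)).map (algebraMap L k)
      = ((s.map φ).map fun x => X - C x).prod := by
    rw [Polynomial.map_map, key, ← Polynomial.map_map, hs, map_prod_X_sub_C]
  have hfa' : ((f.map (MvPolynomial.eval a)).map (σ : L →+* L)).map (algebraMap L k)
      = ((s'.map φ).map fun x => X - C x).prod := by
    rw [← map_prod_X_sub_C, ← hs', Polynomial.map_map _ φ, ← key, Polynomial.map_map (MvPolynomial.eval a),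
      ← Polynomial.map_map _ (algebraMap L k), Polynomial.map_map (MvPolynomial.map _)]
    congr 2
    refine RingHom.ext fun p => ?_
    simp only [RingHom.comp_apply]
    rw [← MvPolynomial.eval_comp_map]
    congr 2
    funext t
    simp [ha]
  have hfm : (f.map (MvPolynomial.eval a)).Monic := hf.map _
  have hcard : f.natDegree = s.card := by
    rw [← natDegree_prod_X_sub_C s, ← hs, hf.natDegree_map]
  have hne : f.map (MvPolynomial.eval a) ≠ 1 := fun h1 => hpos (by
    rw [← hf.natDegree_map (MvPolynomial.eval a), h1, natDegree_one])
  rw [hfm.irreducible_iff_lt_natDegree_lt hne]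
  rintro q hq hqd hqf
  rw [hf.natDegree_map, Finset.mem_Ioc] at hqd
  -- The roots of the factor `q` are lifted to a sub-multiset of the generic roots, so that its
  -- coefficients are specializations of generic ones.
  obtain ⟨S, hSs, hSφ⟩ : ∃ S ≤ s, S.map φ = (q.map (algebraMap L k)).roots := by
    apply Multiset.exists_le_map_eq
    rw [← roots_multiset_prod_X_sub_C (s.map φ), ← hfa]
    exact roots.le_of_dvd (hfm.map _).ne_zero (Polynomial.map_dvd _ hqf)
  have hqprod : ∀ q : L[X], q.Monic → q.map (algebraMap L k)
      = ((q.map (algebraMap L k)).roots.map fun x => X - C x).prod := fun q hq => by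
    have := (IsAlgClosed.splits (q.map (algebraMap L k))).eq_prod_roots
    rwa [(hq.map _).leadingCoeff, C_1, one_mul] at this
  have hqS : q.map (algebraMap L k) = (S.map fun x => X - C x).prod.map φ := by
    rw [map_prod_X_sub_C, hSφ]
    exact hqprod q hq
  have hScard : S.card = q.natDegree := by
    rw [← hq.natDegree_map (algebraMap L k), hqS, (monic_prod_X_sub_C S).natDegree_map,
      natDegree_prod_X_sub_C]
  obtain ⟨j, hj⟩ := h S hSs (by omega) (by omega)
  have hcoeff : φ ((S.map fun x => X - C x).prod.coeff j) = algebraMap L k (q.coeff j) := by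
    rw [← coeff_map, ← coeff_map, hqS]
  rw [hcoeff] at hj
  rcases hj with hj | hj
  · exact hj ⟨_, rfl⟩
  · obtain ⟨g, hg, hgM⟩ := exists_gal_apply_ne_of_notMem _ _ hj
    have hgY := hY g fun x hx => hgM x (by
      have h1 := hφ (MvPolynomial.C x)
      rw [MvPolynomial.eval_C] at h1
      rw [← h1]
      exact IntermediateField.subset_adjoin _ _ ⟨_, Or.inr hx, rfl⟩)
    -- σ(q_j) is a coefficient of q^σ, whose roots are among φ(s'); so it lies in the field whose
    -- elements of `L` are fixed by `g`.
    have hσ : g (σ (q.coeff j)) = σ (q.coeff j) := by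
      apply hgM
      have hqσ : (q.map (σ : L →+* L)).Monic := hq.map _
      have h1 : algebraMap L k (σ (q.coeff j))
          = ((q.map (σ : L →+* L)).map (algebraMap L k)).coeff j := by
        rw [coeff_map, coeff_map]; rfl
      rw [h1, hqprod _ hqσ]
      refine coeff_prod_X_sub_C_mem (IntermediateField.adjoin K
        (φ '' ({x | x ∈ s'} ∪ Y))).toSubring _ (fun x hx => ?_) j
      have h2 : x ∈ s'.map φ := by
        rw [← roots_multiset_prod_X_sub_C (s'.map φ), ← hfa']
        exact Multiset.mem_of_le (roots.le_of_dvd ((hfm.map _).map _).ne_zero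
          (Polynomial.map_dvd _ (Polynomial.map_dvd _ hqf))) hx
      obtain ⟨z, hz, rfl⟩ := Multiset.mem_map.1 h2
      exact IntermediateField.subset_adjoin _ _ ⟨z, Or.inl hz, rfl⟩
    rw [hgY] at hσ
    exact hg (σ.injective hσ)

theorem RingHom.isIntegralElem_coeff_prod_X_sub_C {P B : Type*} [CommRing P] [CommRing B]
    (h : P →+* B) (s : Multiset B) (hs : ∀ x ∈ s, h.IsIntegralElem x) (j : ℕ) :
    h.IsIntegralElem ((s.map fun x => X - C x).prod.coeff j) := by
  let _ : Algebra P B := h.toAlgebra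
  exact coeff_prod_X_sub_C_mem (integralClosure P B).toSubring s hs j

theorem eval₂_eq_zero_of_map_eq_prod {P B : Type*} [CommRing P] [CommRing B]
    (h : P →+* B) (f : P[X]) (s : Multiset B) (hs : f.map h = (s.map fun x => X - C x).prod)
    (x : B) (hx : x ∈ s) : eval₂ h x f = 0 := by
  rw [← eval_map, hs, eval_multiset_prod, Multiset.map_map]
  exact Multiset.prod_eq_zero (Multiset.mem_map.2 ⟨x, hx, by simp⟩)

theorem isSeparable_map_of_separable_fractionRing {P Ω : Type*} [CommRing P] [IsDomain P] [Field Ω]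
    (θ : P →+* Ω) (hθ : Function.Injective θ) (f : P[X])
    (hf : (f.map (algebraMap P (FractionRing P))).Separable) : (f.map θ).Separable := by
  have h := Separable.map (f := IsFractionRing.lift (K := FractionRing P) hθ) hf
  rwa [Polynomial.map_map, show (IsFractionRing.lift (K := FractionRing P) hθ).comp
    (algebraMap P (FractionRing P)) = θ from
    RingHom.ext fun x => IsFractionRing.lift_algebraMap hθ x] at h

/-- All partial products of the generic roots are treated at once. `B` stands for an integral
closure of k[t, t'] containing these roots; keeping it abstract separates the argument from the
construction of the algebra structures. -/
theorem exists_eval_irreducible_of_monic_aux {K L k ι B : Type*} (Ω : Type*) [Field K] [Field L] [Field k] [Algebra K L] [Algebra L k]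
    [Algebra K k] [IsScalarTower K L k] [IsGalois K L] [IsAlgClosed k] [Finite ι]
    [CommRing B] [IsDomain B] [Field Ω] [IsAlgClosed Ω] [Algebra B Ω] [IsIntegrallyClosedIn B Ω]
    [Algebra (MvPolynomial (ι ⊕ ι) k) B] [Algebra.IsIntegral (MvPolynomial (ι ⊕ ι) k) B]
    [Algebra (MvPolynomial (ι ⊕ ι) K) B] [Algebra (MvPolynomial (ι ⊕ ι) K) Ω]
    [Algebra (FractionRing (MvPolynomial (ι ⊕ ι) K)) Ω] [IsScalarTower (MvPolynomial (ι ⊕ ι) K) B Ω]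
    [IsScalarTower (MvPolynomial (ι ⊕ ι) K) (FractionRing (MvPolynomial (ι ⊕ ι) K)) Ω]
    [Algebra.IsIntegral (MvPolynomial (ι ⊕ ι) K) B]
    (hK : IsHilbertian K)
    (hB : Function.Injective (algebraMap (MvPolynomial (ι ⊕ ι) k) B))
    (hKB : ∀ p, algebraMap (MvPolynomial (ι ⊕ ι) K) B p
      = algebraMap (MvPolynomial (ι ⊕ ι) k) B (MvPolynomial.map (algebraMap K k) p))
    (σ : Gal(L/K)) (Y : Set L) (hYfin : Y.Finite)
    (hY : ∀ g : Gal(L/K), (∀ x ∈ Y, g x = x) → ∀ x, g (σ x) = σ (g x))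
    (α : L) (hα : σ α ≠ α) {J : Type*} [Finite J] (f : J → (MvPolynomial ι L)[X])
    (hf : ∀ j, (f j).Monic) (hirr : ∀ j, Irreducible (f j))
    (hsep : ∀ j, ((f j).map (algebraMap (MvPolynomial ι L)
      (FractionRing (MvPolynomial ι L)))).Separable)
    (g : MvPolynomial ι L) (hg : g ≠ 0) :
    ∃ a : ι → L, MvPolynomial.eval a g ≠ 0 ∧
      ∀ j, Irreducible ((f j).map (MvPolynomial.eval a)) := by
  classical
  have := Fintype.ofFinite J
  have hBΩ : Function.Injective (algebraMap B Ω) := (isIntegrallyClosedIn_iff.1 ‹_›).1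
  let R := MvPolynomial (ι ⊕ ι) k
  let A := MvPolynomial (ι ⊕ ι) K
  let Q := FractionRing A
  let i : MvPolynomial (ι ⊕ ι) L →+* B :=
    (algebraMap R B).comp (MvPolynomial.map (algebraMap L k))
  have hi : Function.Injective i :=
    hB.comp (MvPolynomial.map_injective _ (algebraMap L k).injective)
  let fσ : J → (MvPolynomial ι L)[X] := fun j => (f j).map (MvPolynomial.map (σ : L →+* L))
  have hfσ : ∀ j, (fσ j).Monic := fun j => (hf j).map _
  have hθσ : Function.Injective ((algebraMap (MvPolynomial ι L) (FractionRing (MvPolynomial ι L))).comp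
      (MvPolynomial.map (σ : L →+* L))) :=
    (IsFractionRing.injective (MvPolynomial ι L) (FractionRing (MvPolynomial ι L))).comp
      (MvPolynomial.map_injective (σ : L →+* L) σ.injective)
  have hsepσ : ∀ j, ((fσ j).map (algebraMap (MvPolynomial ι L)
      (FractionRing (MvPolynomial ι L)))).Separable := fun j => by
    rw [Polynomial.map_map]
    exact isSeparable_map_of_separable_fractionRing _ hθσ _ (hsep j)
  -- linear factors of the pullbacks along the two pencils
  choose s hs using fun j => exists_eq_prod_X_sub_C (Ω := Ω)
    ((f j).map (i.comp (pencil ι α).toRingHom)) ((hf j).map _)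
  choose s' hs' using fun j => exists_eq_prod_X_sub_C (Ω := Ω)
    ((fσ j).map (i.comp (pencil ι (σ α)).toRingHom)) ((hfσ j).map _)
  have hmem : ∀ p, algebraMap B Ω (i p) ∈ separableClosure Q Ω :=
    ringHom_mem_separableClosure ((algebraMap B Ω).comp i) fun p => by
      change algebraMap B Ω (algebraMap R B (MvPolynomial.map (algebraMap L k)
        (MvPolynomial.map (algebraMap K L) p))) = _
      rw [MvPolynomial.map_map, ← IsScalarTower.algebraMap_eq, ← hKB,
        ← IsScalarTower.algebraMap_apply, ← IsScalarTower.algebraMap_apply]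
  have hroot : ∀ (β : L) (q : (MvPolynomial ι L)[X]) (t : Multiset B),
      (q.map (algebraMap (MvPolynomial ι L) (FractionRing (MvPolynomial ι L)))).Separable →
      q.map (i.comp (pencil ι β).toRingHom) = (t.map fun x => X - C x).prod →
      ∀ x ∈ t, IsSeparable Q (algebraMap B Ω x) := fun β q t hq ht x hx => by
    have hinj : Function.Injective ((algebraMap B Ω).comp (i.comp (pencil ι β).toRingHom)) :=
      hBΩ.comp (hi.comp (pencil_injective ι β))
    refine isSeparable_of_isRoot_of_coeff_mem_separableClosure _
      (isSeparable_map_of_separable_fractionRing _ hinj q hq) (fun n => ?_) _ ?_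
    · rw [coeff_map]
      exact hmem _
    · rw [IsRoot, eval_map, ← hom_eval₂, eval₂_eq_zero_of_map_eq_prod _ q t ht x hx, map_zero]
  have hik : ∀ β : L, i.comp (pencil ι β).toRingHom
      = ((algebraMap R B).comp (pencil ι (algebraMap L k β)).toRingHom).comp
        (MvPolynomial.map (algebraMap L k)) := fun β => RingHom.ext fun p =>
    congrArg (algebraMap R B) (map_pencil _ _ _)
  have hint : ∀ (β : L) (q : (MvPolynomial ι L)[X]) (t : Multiset B), q.Monic →
      q.map (i.comp (pencil ι β).toRingHom) = (t.map fun x => X - C x).prod →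
      ∀ x ∈ t, ((algebraMap R B).comp (pencil ι (algebraMap L k β)).toRingHom).IsIntegralElem x :=
    fun β q t hq ht x hx => ⟨q.map (MvPolynomial.map (algebraMap L k)), hq.map _, by
      rw [eval₂_map, ← hik]
      exact eval₂_eq_zero_of_map_eq_prod _ q t ht x hx⟩
  -- the relevant coefficients
  let T := Σ j : J, {S : Multiset B // S ∈ (s j).powerset.toFinset ∧ 0 < S.card ∧
    S.card < (s j).card}
  have hTfin : Finite T := by
    have : ∀ j, Finite {S : Multiset B // S ∈ (s j).powerset.toFinset ∧ 0 < S.card ∧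
        S.card < (s j).card} := fun j =>
      Set.Finite.subset (Finset.finite_toSet (s j).powerset.toFinset) fun S hS => hS.1
    infer_instance
  have := Fintype.ofFinite T
  have hTle : ∀ t : T, t.2.1 ≤ s t.1 := fun t => by
    have := t.2.2.1
    rwa [Multiset.mem_toFinset, Multiset.mem_powerset] at this
  choose n hn using fun t : T => exists_coeff_prod_notMem_range i hi α (f t.1) (hf t.1) (hirr t.1)
    (s t.1) (hs t.1) t.2.1 (hTle t) t.2.2.2.1 t.2.2.2.2
  let y : T → B := fun t => (t.2.1.map fun x => X - C x).prod.coeff (n t)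
  let Z : Set B := (fun x => i (MvPolynomial.C x)) '' Y
  let X' : T → Set B := fun t => {x | x ∈ s' t.1} ∪ Z
  have hsepy : ∀ t, IsSeparable Q (algebraMap B Ω (y t)) := fun t =>
    coeff_prod_X_sub_C_mem ((separableClosure Q Ω).toSubring.comap (algebraMap B Ω)) _
      (fun x hx => hroot α _ _ (hsep _) (hs _) x (Multiset.mem_of_le (hTle t) hx)) _
  have hX'fin : ∀ t, (X' t).Finite := fun t =>
    ((s' t.1).toFinset.finite_toSet.subset fun x hx => Multiset.mem_toFinset.2 hx).union
      (hYfin.image _)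
  have hX'sep : ∀ t, ∀ x ∈ X' t, IsSeparable Q (algebraMap B Ω x) := by
    rintro t _ (hx | ⟨c, hc, rfl⟩)
    · exact hroot (σ α) _ _ (hsepσ _) (hs' _) _ hx
    · exact hmem _
  -- Coefficients that are not polynomials over `k` are the ones to which independence of the
  -- pencils applies.
  let T₂ := {t : T // y t ∉ (algebraMap R B).range}
  have hyX' : ∀ t : T₂, algebraMap B Ω (y t.1) ∉
      IntermediateField.adjoin Q (algebraMap B Ω '' X' t.1) := fun t hmem' => by
    obtain ⟨d, hd, hdy⟩ := exists_smul_mem_adjoin_of_mem_adjoin (A := A) Q Ω hBΩ _ _ hmem'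
    apply t.2
    have hne : algebraMap L k α ≠ algebraMap L k (σ α) := fun h =>
      hα ((algebraMap L k).injective h.symm)
    refine mem_range_of_smul_mem_adjoin hB hne (y t.1)
      (RingHom.isIntegralElem_coeff_prod_X_sub_C _ _ (fun x hx =>
        hint α _ _ (hf _) (hs _) x (Multiset.mem_of_le (hTle t.1) hx)) _) (X' t.1) ?_
      (MvPolynomial.map (algebraMap K k) d)
      ((map_ne_zero_iff _ (MvPolynomial.map_injective _ (algebraMap K k).injective)).2 hd) ?_
    · rintro _ (hx | ⟨c, hc, rfl⟩)
      · exact hint (σ α) _ _ (hfσ _) (hs' _) _ hx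
      · have h1 : i (MvPolynomial.C c) = ((algebraMap R B).comp
            (pencil ι (algebraMap L k (σ α))).toRingHom) (MvPolynomial.C (algebraMap L k c)) := by
          simp only [i, RingHom.comp_apply, AlgHom.toRingHom_eq_coe, RingHom.coe_coe, pencil,
            MvPolynomial.algHom_C, MvPolynomial.algebraMap_eq]
          rw [MvPolynomial.map_C]
        change RingHom.IsIntegralElem _ (i (MvPolynomial.C c))
        rw [h1]
        exact RingHom.isIntegralElem_map _
    · rw [Algebra.smul_def, ← hKB, ← Algebra.smul_def]
      generalize d • y t.1 = z at hdy
      induction hdy using Algebra.adjoin_induction with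
      | mem x hx => exact Algebra.subset_adjoin hx
      | algebraMap r => rw [hKB]; exact Subalgebra.algebraMap_mem _ _
      | add x y _ _ hx hy => exact add_mem hx hy
      | mul x y _ _ hx hy => exact mul_mem hx hy
  -- avoiding `L`-rational values of the coefficients that are polynomials
  have hlin : ∀ t : T, ∃ h : A, h ≠ 0 ∧ ∀ r, algebraMap R B r = y t → ∀ b : ι ⊕ ι → K,
      MvPolynomial.eval b h ≠ 0 →
      MvPolynomial.eval (algebraMap K k ∘ b) r ∉ (algebraMap L k).range := fun t => by
    by_cases ht : y t ∈ (algebraMap R B).range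
    · obtain ⟨r, hr⟩ := ht
      have hrL : r ∉ Set.range (MvPolynomial.map (σ := ι ⊕ ι) (algebraMap L k)) := by
        rintro ⟨q, rfl⟩
        exact hn t ⟨q, hr⟩
      rw [MvPolynomial.mem_range_map_iff_coeffs_subset] at hrL
      obtain ⟨c, hc, hcL⟩ := Set.not_subset.1 hrL
      obtain ⟨m, hm, rfl⟩ := MvPolynomial.mem_coeffs_iff.1 hc
      obtain ⟨h, hh0, hh⟩ := MvPolynomial.exists_forall_eval_notMem
        (LinearMap.range (IsScalarTower.toAlgHom K L k).toLinearMap) r m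
        (fun ⟨l, hl⟩ => hcL ⟨l, hl⟩)
      refine ⟨h, hh0, fun r' hr' b hb ⟨l, hl⟩ => hh b hb ⟨l, ?_⟩⟩
      rw [hB (hr.trans hr'.symm)]
      exact hl
    · exact ⟨1, one_ne_zero, fun r hr => absurd ⟨r, hr⟩ ht⟩
  choose h hh0 hh using hlin
  obtain ⟨g₀, hg₀, hgb⟩ : ∃ g₀ : A, g₀ ≠ 0 ∧ ∀ b : ι ⊕ ι → K, MvPolynomial.eval b g₀ ≠ 0 →
      MvPolynomial.eval (algebraMap K L ∘ b) (pencil ι α g) ≠ 0 := by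
    obtain ⟨m, hm⟩ := MvPolynomial.ne_zero_iff.1
      ((map_ne_zero_iff _ (pencil_injective ι α)).2 hg)
    obtain ⟨g₀, hg₀, hgb⟩ := MvPolynomial.exists_forall_eval_notMem (⊥ : Submodule K L) _ m hm
    exact ⟨g₀, hg₀, hgb⟩
  obtain ⟨b, hb, hbφ⟩ := hK.exists_specialization_notMem (Ω := Ω) hBΩ (fun t : T₂ => X' t.1)
    (fun t => hX'fin _) (fun t => hX'sep _) (fun t : T₂ => y t.1) (fun t => hsepy _) hyX'
    (g₀ * ∏ t, h t) (mul_ne_zero hg₀ (Finset.prod_ne_zero_iff.2 fun t _ => hh0 t)) k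
  rw [map_mul, map_prod] at hb
  -- Extending evaluation from k[t, t'], not merely from K[t, t'], makes `φ` the identity on
  -- constants, in particular on `L` and `Y`.
  obtain ⟨φ, hφ⟩ := exists_ringHom_extension hB (MvPolynomial.eval (algebraMap K k ∘ b))
  have hφR : ∀ r, φ (algebraMap R B r) = MvPolynomial.eval (algebraMap K k ∘ b) r := fun r =>
    congrArg (fun h => h r) hφ
  have hφA : φ.comp (algebraMap A B) = (algebraMap K k).comp (MvPolynomial.eval b) :=
    RingHom.ext fun p => by
      rw [RingHom.comp_apply, hKB, hφR, MvPolynomial.eval_comp_map, RingHom.comp_apply]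
  have hKLk : algebraMap K k ∘ b = algebraMap L k ∘ (algebraMap K L ∘ b) := by
    funext t
    exact IsScalarTower.algebraMap_apply K L k (b t)
  have hφi : ∀ p, φ (i p) = algebraMap L k (MvPolynomial.eval (algebraMap K L ∘ b) p) :=
    fun p => by
      change φ (algebraMap R B (MvPolynomial.map _ p)) = _
      rw [hφR, hKLk, MvPolynomial.eval_comp_map]
  refine ⟨fun t => algebraMap K L (b (Sum.inl t)) + α * algebraMap K L (b (Sum.inr t)), ?_,
    fun j => ?_⟩
  · have := hgb b (left_ne_zero_of_mul hb)
    rwa [eval_pencil] at this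
  · refine irreducible_map_eval_of_specialization i φ b hφi σ Z (fun g' hg' => hY g' fun x hx =>
      hg' x ⟨x, hx, rfl⟩) α (f j) (hf j) (fun h0 => ?_) (s j) (s' j) (hs j) (hs' j)
      fun S hS h0 hlt => ?_
    · have h1 := (hf j).natDegree_eq_zero.1 h0
      exact (hirr j).not_isUnit (h1 ▸ isUnit_one)
    · let t : T := ⟨j, S, Multiset.mem_toFinset.2 (Multiset.mem_powerset.2 hS), h0, hlt⟩
      refine ⟨n t, ?_⟩
      change φ (y t) ∉ _ ∨ φ (y t) ∉ IntermediateField.adjoin K (φ '' X' t)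
      by_cases ht : y t ∈ (algebraMap R B).range
      · left
        obtain ⟨r, hr⟩ := ht
        rw [← hr, hφR]
        exact hh t r hr b (Finset.prod_ne_zero_iff.1 (right_ne_zero_of_mul hb) t
          (Finset.mem_univ t))
      · right
        exact hbφ φ hφA ⟨t, ht⟩

theorem exists_eval_irreducible_of_monic_of_isAlgClosed {K L ι k Ω : Type*} [Field K] [Field L] [Algebra K L]
    [IsGalois K L] [Finite ι] [Field k] [IsAlgClosed k] [Algebra K k] [Algebra L k]
    [IsScalarTower K L k] [Algebra.IsAlgebraic L k] [Field Ω] [IsAlgClosed Ω]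
    [Algebra (MvPolynomial (ι ⊕ ι) k) Ω]
    (hRΩ : Function.Injective (algebraMap (MvPolynomial (ι ⊕ ι) k) Ω)) (hK : IsHilbertian K)
    (σ : Gal(L/K)) (Y : Set L) (hYfin : Y.Finite)
    (hY : ∀ g : Gal(L/K), (∀ x ∈ Y, g x = x) → ∀ x, g (σ x) = σ (g x))
    (α : L) (hα : σ α ≠ α) {J : Type*} [Finite J] (f : J → (MvPolynomial ι L)[X])
    (hf : ∀ j, (f j).Monic) (hirr : ∀ j, Irreducible (f j))
    (hsep : ∀ j, ((f j).map (algebraMap (MvPolynomial ι L)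
      (FractionRing (MvPolynomial ι L)))).Separable)
    (g : MvPolynomial ι L) (hg : g ≠ 0) :
    ∃ a : ι → L, MvPolynomial.eval a g ≠ 0 ∧
      ∀ j, Irreducible ((f j).map (MvPolynomial.eval a)) := by
  let R := MvPolynomial (ι ⊕ ι) k
  let A := MvPolynomial (ι ⊕ ι) K
  let B := integralClosure R Ω
  let c : A →+* R := MvPolynomial.map (algebraMap K k)
  have hc : Function.Injective c := MvPolynomial.map_injective _ (algebraMap K k).injective
  have hRB : Function.Injective (algebraMap R B) := fun x y hxy => hRΩ (congrArg Subtype.val hxy)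
  have hAΩ : Function.Injective ((algebraMap R Ω).comp c) := hRΩ.comp hc
  let _ : Algebra A B := ((algebraMap R B).comp c).toAlgebra
  let _ : Algebra A Ω := ((algebraMap R Ω).comp c).toAlgebra
  let _ : Algebra (FractionRing A) Ω :=
    (IsFractionRing.lift (A := A) (K := FractionRing A) hAΩ).toAlgebra
  have : IsScalarTower A B Ω := IsScalarTower.of_algebraMap_eq fun _ => rfl
  have : IsScalarTower A (FractionRing A) Ω := IsScalarTower.of_algebraMap_eq fun x =>
    (IsFractionRing.lift_algebraMap hAΩ x).symm
  have : Algebra.IsAlgebraic K k := Algebra.IsAlgebraic.trans K L k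
  have hcint : c.IsIntegral := fun p => by
    let _ : Algebra A R := c.toAlgebra
    change IsIntegral A p
    induction p using MvPolynomial.induction_on with
    | C a =>
      obtain ⟨q, hq, hqa⟩ := Algebra.IsIntegral.isIntegral (R := K) a
      refine ⟨q.map MvPolynomial.C, hq.map _, ?_⟩
      have h : (algebraMap A R).comp MvPolynomial.C = (MvPolynomial.C).comp (algebraMap K k) :=
        RingHom.ext fun x => MvPolynomial.map_C _ x
      rw [eval₂_map, h, ← hom_eval₂, hqa, map_zero]
    | add p q hp hq => exact hp.add hq
    | mul_X p i hp =>
      refine hp.mul ?_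
      have h : algebraMap A R (MvPolynomial.X i) = MvPolynomial.X i := MvPolynomial.map_X _ i
      rw [← h]
      exact isIntegral_algebraMap
  have : Algebra.IsIntegral A B := ⟨RingHom.IsIntegral.trans c (algebraMap R B) hcint
    fun x => Algebra.IsIntegral.isIntegral x⟩
  exact exists_eval_irreducible_of_monic_aux (k := k) (B := B) Ω hK hRB (fun _ => rfl) σ Y hYfin hY
    α hα f hf hirr hsep g hg

theorem exists_eval_irreducible_of_monic {K L ι : Type*} [Field K] [Field L] [Algebra K L]
    [IsGalois K L] [Finite ι] (hK : IsHilbertian K)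
    (σ : Gal(L/K)) (Y : Set L) (hYfin : Y.Finite)
    (hY : ∀ g : Gal(L/K), (∀ x ∈ Y, g x = x) → ∀ x, g (σ x) = σ (g x))
    (α : L) (hα : σ α ≠ α) {J : Type*} [Finite J] (f : J → (MvPolynomial ι L)[X])
    (hf : ∀ j, (f j).Monic) (hirr : ∀ j, Irreducible (f j))
    (hsep : ∀ j, ((f j).map (algebraMap (MvPolynomial ι L)
      (FractionRing (MvPolynomial ι L)))).Separable)
    (g : MvPolynomial ι L) (hg : g ≠ 0) :
    ∃ a : ι → L, MvPolynomial.eval a g ≠ 0 ∧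
      ∀ j, Irreducible ((f j).map (MvPolynomial.eval a)) := by
  let k := AlgebraicClosure L
  let R := MvPolynomial (ι ⊕ ι) k
  let Ω := AlgebraicClosure (FractionRing R)
  have hRΩ : Function.Injective (algebraMap R Ω) := by
    rw [IsScalarTower.algebraMap_eq R (FractionRing R) Ω]
    exact (algebraMap (FractionRing R) Ω).injective.comp (IsFractionRing.injective R _)
  exact exists_eval_irreducible_of_monic_of_isAlgClosed hRΩ hK σ Y hYfin hY
    α hα f hf hirr hsep g hg

/-! ### Criteria for a Galois extension to be Hilbertian -/

/-- A Galois extension `L` of a Hilbertian field `K` is Hilbertian if some nontrivial automorphism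
commutes with all automorphisms that fix a given finite set of elements of `L`. -/
theorem IsHilbertian.of_exists_gal_commute {K L : Type*} [Field K] [Field L] [Algebra K L]
    [IsGalois K L] (hK : IsHilbertian K) (σ : Gal(L/K)) (hσ : σ ≠ 1) (Y : Set L)
    (hYfin : Y.Finite) (hY : ∀ g : Gal(L/K), (∀ x ∈ Y, g x = x) → g * σ = σ * g) :
    IsHilbertian L := by
  obtain ⟨α, hα⟩ : ∃ α, σ α ≠ α := by
    by_contra! h
    exact hσ (AlgEquiv.ext h)
  intro r m f g hg hirr hsep
  have hf0 : ∀ j, f j ≠ 0 := fun j h => (hirr j).ne_zero (by rw [h, Polynomial.map_zero])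
  have hlc : ∀ j, (f j).leadingCoeff ≠ 0 := fun j => leadingCoeff_ne_zero.2 (hf0 j)
  have hmap : ∀ j, (f j).integralNormalization.map (algebraMap (MvPolynomial (Fin r) L)
      (FractionRing (MvPolynomial (Fin r) L))) = ((f j).map (algebraMap (MvPolynomial (Fin r) L)
      (FractionRing (MvPolynomial (Fin r) L)))).integralNormalization := fun j =>
    (integralNormalization_map _ _
      ((map_ne_zero_iff _ (IsFractionRing.injective _ _)).2 (hlc j))).symm
  have hmonic : ∀ j, (f j).integralNormalization.Monic := fun j =>
    monic_integralNormalization (hf0 j)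
  obtain ⟨a, ha, hai⟩ := exists_eval_irreducible_of_monic hK σ Y hYfin
    (fun τ hτ x => congrArg (fun h => h x) (hY τ hτ)) α hα
    (fun j => (f j).integralNormalization) hmonic
    (fun j => by
      rw [(hmonic j).irreducible_iff_irreducible_map_fraction_map
        (K := FractionRing (MvPolynomial (Fin r) L)), hmap]
      exact (irreducible_integralNormalization_iff (hirr j).ne_zero).2 (hirr j))
    (fun j => by
      rw [hmap]
      exact separable_integralNormalization (hirr j) (hsep j))
    -- Nonvanishing of the leading coefficients at `a` lets normalization commute with evaluation.
    (g * ∏ j, (f j).leadingCoeff)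
    (mul_ne_zero hg (Finset.prod_ne_zero_iff.2 fun j _ => hlc j))
  rw [map_mul, map_prod] at ha
  refine ⟨a, left_ne_zero_of_mul ha, fun j => ?_⟩
  have hj : MvPolynomial.eval a (f j).leadingCoeff ≠ 0 :=
    Finset.prod_ne_zero_iff.1 (right_ne_zero_of_mul ha) j (Finset.mem_univ j)
  have h := hai j
  rw [← integralNormalization_map _ _ hj] at h
  refine (irreducible_integralNormalization_iff fun h0 => hj ?_).1 h
  rw [leadingCoeff, ← coeff_map, h0, coeff_zero]

theorem IsHilbertian.of_ringEquiv {K L : Type*} [Field K] [Field L] (e : K ≃+* L)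
    (hK : IsHilbertian K) : IsHilbertian L := by
  intro r m f g hg hirr hsep
  let E : MvPolynomial (Fin r) L ≃+* MvPolynomial (Fin r) K := MvPolynomial.mapEquiv _ e.symm
  let E' : FractionRing (MvPolynomial (Fin r) L) ≃+* FractionRing (MvPolynomial (Fin r) K) :=
    IsFractionRing.ringEquivOfRingEquiv E
  have hE : ∀ j, ((f j).map (E : MvPolynomial (Fin r) L →+* MvPolynomial (Fin r) K)).map
      (algebraMap _ (FractionRing (MvPolynomial (Fin r) K)))
      = ((f j).map (algebraMap _ (FractionRing (MvPolynomial (Fin r) L)))).map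
        (E' : FractionRing (MvPolynomial (Fin r) L) →+* _) := fun j => by
    rw [Polynomial.map_map, Polynomial.map_map]
    congr 1
    exact RingHom.ext fun x => (IsFractionRing.ringEquivOfRingEquiv_algebraMap E x).symm
  obtain ⟨a, ha, hai⟩ := hK r m (fun j => (f j).map (E : MvPolynomial (Fin r) L →+* MvPolynomial (Fin r) K)) (E g)
    ((map_ne_zero_iff _ E.injective).2 hg)
    (fun j => by
      rw [hE]
      exact (MulEquiv.irreducible_iff (Polynomial.mapEquiv E')).2 (hirr j))
    (fun j => by
      rw [hE]
      exact (hsep j).map)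
  have hev : ∀ p, MvPolynomial.eval (e ∘ a) p = e (MvPolynomial.eval a (E p)) := fun p => by
    have h := MvPolynomial.eval_comp_map (e : K →+* L) a (E p)
    have h2 : MvPolynomial.map (e : K →+* L) (E p) = p := by
      change MvPolynomial.map (e : K →+* L) (MvPolynomial.map (e.symm : L →+* K) p) = p
      rw [MvPolynomial.map_map, RingEquiv.comp_symm, MvPolynomial.map_id]
    rwa [h2] at h
  refine ⟨e ∘ a, ?_, fun j => ?_⟩
  · rw [hev]
    exact (map_ne_zero_iff _ e.injective).2 ha
  · have h := (MulEquiv.irreducible_iff (Polynomial.mapEquiv e)).2 (hai j)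
    have h2 : (f j).map (MvPolynomial.eval (e ∘ a))
        = Polynomial.mapEquiv e (((f j).map (E : MvPolynomial (Fin r) L →+* MvPolynomial (Fin r) K)).map
          (MvPolynomial.eval a)) := by
      rw [Polynomial.mapEquiv_apply, Polynomial.map_map, Polynomial.map_map]
      congr 1
      exact RingHom.ext fun p => hev p
    rw [h2]
    exact h

/-- A Galois extension of a Hilbertian field is Hilbertian if its Galois group has a nontrivial
finite normal subgroup. -/
theorem IsHilbertian.of_finite_normal {K L : Type*} [Field K] [Field L] [Algebra K L]
    [IsGalois K L] (hK : IsHilbertian K) (P : Subgroup Gal(L/K)) [hP : P.Normal] [Finite P]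
    (hne : P ≠ ⊥) : IsHilbertian L := by
  obtain ⟨σ, hσP, hσ⟩ := P.bot_or_exists_ne_one.resolve_left hne
  have hex : ∀ p q : Gal(L/K), ∃ x : L, p ≠ q → p x ≠ q x := fun p q => by
    by_cases h : p = q
    · exact ⟨0, fun h' => absurd h h'⟩
    · by_contra! h'
      exact h (AlgEquiv.ext fun x => (h' x).2)
  choose x hx using hex
  -- `Y` consists of the `P`-translates of points separating pairs in `P`. If `g` fixes `Y`, then
  -- gσg⁻¹ ∈ P agrees with σ at the point separating the two, so they are equal.
  refine hK.of_exists_gal_commute σ hσ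
    (Set.range fun t : P × P × P => (t.1 : Gal(L/K)) (x t.2.1 t.2.2)) (Set.finite_range _)
    fun g hg => ?_
  by_contra hgσ
  let τ : Gal(L/K) := g * σ * g⁻¹
  have hτP : τ ∈ P := hP.conj_mem _ hσP g
  have hne' : τ ≠ σ := fun h => hgσ (mul_inv_eq_iff_eq_mul.1 h)
  apply hx τ σ hne'
  have h1 : g (x τ σ) = x τ σ := hg _ ⟨(1, ⟨τ, hτP⟩, ⟨σ, hσP⟩), rfl⟩
  have h2 : g (σ (x τ σ)) = σ (x τ σ) := hg _ ⟨(⟨σ, hσP⟩, ⟨τ, hτP⟩, ⟨σ, hσP⟩), rfl⟩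
  have h3 : g⁻¹ (x τ σ) = x τ σ := by
    conv_lhs => rw [← h1]
    exact g.symm_apply_apply _
  change g (σ (g⁻¹ (x τ σ))) = _
  rw [h3, h2]

/-! ### Climbing the stages -/

/-- The factors generate a dense subgroup of the product; if the continuous map `π` kills each
factor, it is trivial, and otherwise a factor that survives is the required subgroup. -/
theorem IsOneStage.eq_one_or_exists_finite_normal {N Γ : Type*} [Group N] [TopologicalSpace N]
    (hN : IsOneStage N) [Group Γ] [TopologicalSpace Γ] [T1Space Γ] (π : N →* Γ)
    (hπ : Continuous π) : π = 1 ∨ ∃ P : Subgroup N, P.Normal ∧ Finite P ∧ P.map π ≠ ⊥ := by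
  classical
  rcases hN with hN | ⟨I, S, _, _, hd, hf, -, ⟨e⟩⟩
  · left
    ext x
    rw [Subsingleton.elim x 1, map_one, map_one]
  let P : I → Subgroup N := fun i =>
    ((MonoidHom.mulSingle S i).range).comap (e : N →* ∀ i, S i)
  have hPn : ∀ i, (P i).Normal := fun i => by
    have : ((MonoidHom.mulSingle S i).range).Normal := ⟨by
      rintro _ ⟨s, rfl⟩ g
      refine ⟨g i * s * (g i)⁻¹, ?_⟩
      ext j
      rcases eq_or_ne j i with rfl | hj
      · simp
      · simp [hj]⟩
    exact this.comap _
  have hPf : ∀ i, Finite (P i) := fun i => by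
    have h1 : Finite (MonoidHom.mulSingle S i).range :=
      Finite.of_surjective _ (MonoidHom.mulSingle S i).rangeRestrict_surjective
    exact Finite.of_injective (fun x : P i => (⟨e x, x.2⟩ : (MonoidHom.mulSingle S i).range))
      fun x y h => Subtype.ext (e.injective (congrArg Subtype.val h))
  by_cases hall : ∀ i, (P i).map π = ⊥
  · left
    have hsingle : ∀ i (s : S i), π (e.symm (Pi.mulSingle i s)) = 1 := fun i s => by
      have : π (e.symm (Pi.mulSingle i s)) ∈ (P i).map π :=
        ⟨_, ⟨s, by simp⟩, rfl⟩
      rwa [hall i, Subgroup.mem_bot] at this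
    ext n
    obtain ⟨x, rfl⟩ := e.symm.surjective n
    have hfin : ∀ F : Finset I, π (e.symm (F.piecewise x 1)) = 1 := fun F => by
      induction F using Finset.induction_on with
      | empty => simp
      | insert i F hi ih =>
        have : (insert i F).piecewise x 1 = Pi.mulSingle i (x i) * F.piecewise x 1 := by
          ext j
          rcases eq_or_ne j i with rfl | hj
          · simp [hi]
          · by_cases hjF : j ∈ F <;> simp [hj, hjF]
        rw [this, map_mul, map_mul, hsingle, ih, one_mul]
    -- Every element is the limit of its truncations to finite sets of coordinates, on which `π` is
    -- already trivial.
    have hlim : Filter.Tendsto (fun F : Finset I => F.piecewise x 1) Filter.atTop (nhds x) := by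
      rw [tendsto_pi_nhds]
      intro i
      refine tendsto_const_nhds.congr' ?_
      filter_upwards [Filter.eventually_ge_atTop {i}] with F hF
      rw [Finset.piecewise_eq_of_mem _ _ _ (hF (Finset.mem_singleton_self i))]
    have hcont : Continuous fun x => π (e.symm x) := hπ.comp e.symm.continuous
    have hclosed : IsClosed {x | π (e.symm x) = 1} := isClosed_singleton.preimage hcont
    exact hclosed.mem_of_tendsto hlim (Filter.Eventually.of_forall hfin)
  · right
    push Not at hall
    obtain ⟨i, hi⟩ := hall
    exact ⟨P i, hPn i, hPf i, hi⟩

theorem IsHilbertian.of_isOneStage {K L N : Type*} [Field K] [Field L] [Algebra K L]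
    [IsGalois K L] [Group N] [TopologicalSpace N] (hN : IsOneStage N) (M : IntermediateField K L)
    (hM : IsHilbertian M) (π : N →* Gal(L/K)) (hπ : Continuous π)
    (hrange : π.range = M.fixingSubgroup) : IsHilbertian L := by
  let E := IntermediateField.fixingSubgroupEquiv M
  rcases hN.eq_one_or_exists_finite_normal π hπ with rfl | ⟨P, hPn, hPf, hP⟩
  · have hbot : M.fixingSubgroup = ⊥ := by
      rw [← hrange]
      exact MonoidHom.range_eq_bot_iff.2 rfl
    -- A trivial image leaves nothing above `M`, so `L` is `M` itself.
    have htop : M = ⊤ := by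
      rw [← InfiniteGalois.fixedField_fixingSubgroup M, hbot, IntermediateField.fixedField_bot]
    subst htop
    exact hM.of_ringEquiv (IntermediateField.topEquiv (F := K) (E := L)).toRingEquiv
  · have hle : P.map π ≤ M.fixingSubgroup := by
      rw [← hrange]
      exact Subgroup.map_le_range π P
    let P' : Subgroup Gal(L/M) := ((P.map π).subgroupOf M.fixingSubgroup).map E.toMonoidHom
    have hn : ((P.map π).subgroupOf M.fixingSubgroup).Normal := ⟨by
      rintro ⟨x, hx⟩ hxP ⟨g, hg⟩
      rw [← hrange] at hg
      obtain ⟨n, rfl⟩ := hg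
      obtain ⟨p, hp, hpx⟩ := Subgroup.mem_subgroupOf.1 hxP
      refine Subgroup.mem_subgroupOf.2 ⟨n * p * n⁻¹, hPn.conj_mem _ hp n, ?_⟩
      rw [map_mul, map_mul, hpx, map_inv]
      rfl⟩
    have hn' : P'.Normal := hn.map _ E.surjective
    have hfin : Finite (P.map π) := Set.Finite.image π (Set.toFinite (P : Set N))
    have hfin' : Finite ((P.map π).subgroupOf M.fixingSubgroup) :=
      Finite.of_injective (fun x => (⟨x.1, x.2⟩ : P.map π))
        fun x y h => Subtype.ext (Subtype.ext (congrArg (fun z : P.map π => (z : Gal(L/K))) h))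
    have hfin'' : Finite P' :=
      Set.Finite.image E (Set.toFinite
        (((P.map π).subgroupOf M.fixingSubgroup : Subgroup M.fixingSubgroup) : Set M.fixingSubgroup))
    refine hM.of_finite_normal P' fun h => hP ?_
    rw [Subgroup.map_eq_bot_iff_of_injective _ E.injective, Subgroup.subgroupOf_eq_bot] at h
    exact h.eq_bot_of_le hle

/-- The induction runs over continuous surjections from `G`, not isomorphisms: a surjection onto
Gal(L/K) induces one from G/N onto Gal(M/K), where `M` is the fixed field of the image of `N`, while
`N` itself maps onto Gal(L/M). -/
theorem IsStage.isHilbertian {k : ℕ} {G : Type u} [Group G] [TopologicalSpace G]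
    (hG : IsStage k G) [htg : IsTopologicalGroup G] [hcs : CompactSpace G] (K : Type v) (L : Type w) [Field K]
    [Field L] [Algebra K L] [IsGalois K L] (hK : IsHilbertian K) (π : G →* Gal(L/K))
    (hπ : Continuous π) (hsurj : Function.Surjective π) : IsHilbertian L := by
  induction hG generalizing L htg hcs with
  | one G h =>
    refine IsHilbertian.of_isOneStage (N := G) h (⊥ : IntermediateField K L)
      (hK.of_ringEquiv (IntermediateField.botEquiv K L).symm.toRingEquiv) π hπ ?_
    rw [IntermediateField.fixingSubgroup_bot]
    exact MonoidHom.range_eq_top.2 hsurj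
  | succ k G N hclosed hN hquot ih =>
    have hJn : (N.map π).Normal := Subgroup.Normal.map inferInstance π hsurj
    -- Compactness of `G` makes the image of `N` closed, as the Galois correspondence for infinite
    -- extensions requires.
    have hJc : IsClosed (N.map π : Set Gal(L/K)) :=
      (hclosed.isCompact.image hπ).isClosed
    let M : IntermediateField K L := IntermediateField.fixedField (N.map π)
    have hM : M.fixingSubgroup = N.map π :=
      InfiniteGalois.fixingSubgroup_fixedField (⟨N.map π, hJc⟩ : ClosedSubgroup Gal(L/K))
    have hgal : IsGalois K M := (InfiniteGalois.normal_iff_isGalois M).1 (hM ▸ hJn)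
    let ρ : Gal(L/K) →* Gal(M/K) := AlgEquiv.restrictNormalHom M
    have hρ : Continuous ρ := InfiniteGalois.restrictNormalHom_continuous M
    have hρs : Function.Surjective ρ := AlgEquiv.restrictNormalHom_surjective L
    have hker : ∀ n ∈ N, (ρ.comp π) n = 1 := fun n hn => by
      have h1 : π n ∈ M.fixingSubgroup := hM ▸ Subgroup.mem_map_of_mem π hn
      have h2 : π n ∈ ρ.ker := by
        rw [IntermediateField.restrictNormalHom_ker]
        exact h1
      exact h2
    have hMH : IsHilbertian M := ih M (QuotientGroup.lift N (ρ.comp π) hker)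
      ((hρ.comp hπ).quotient_lift _)
      (QuotientGroup.lift_surjective_of_surjective N _ (hρs.comp hsurj) hker)
    refine IsHilbertian.of_isOneStage hN M hMH (π.comp N.subtype)
      (hπ.comp continuous_subtype_val) ?_
    rw [MonoidHom.range_comp, Subgroup.range_subtype, hM]

/-! ### Stage groups are profinite -/

theorem IsOneStage.compactSpace_t2Space_totallyDisconnectedSpace {G : Type u} [Group G]
    [TopologicalSpace G] (hG : IsOneStage G) :
    CompactSpace G ∧ T2Space G ∧ TotallyDisconnectedSpace G := by
  rcases hG with hG | ⟨I, S, _, _, _, _, -, ⟨e⟩⟩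
  · exact ⟨inferInstance, inferInstance, inferInstance⟩
  · exact ⟨e.symm.toHomeomorph.compactSpace, e.symm.toHomeomorph.t2Space,
      e.symm.toHomeomorph.totallyDisconnectedSpace⟩

theorem IsStage.compactSpace_t2Space_totallyDisconnectedSpace {k : ℕ} {G : Type u} [Group G]
    [TopologicalSpace G] (hG : IsStage k G) [htg : IsTopologicalGroup G] :
    CompactSpace G ∧ T2Space G ∧ TotallyDisconnectedSpace G := by
  induction hG generalizing htg with
  | one G h => exact h.compactSpace_t2Space_totallyDisconnectedSpace
  | succ k G N hclosed hN hquot ih =>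
    obtain ⟨hc, ht, htd⟩ := hN.compactSpace_t2Space_totallyDisconnectedSpace
    obtain ⟨hc', ht', htd'⟩ := ih
    have hNc : IsCompact (N : Set G) := isCompact_iff_compactSpace.2 hc
    -- The point 1 is closed in `N` and `N` is closed in `G`; for topological groups this already
    -- gives Hausdorff.
    have ht1 : T1Space G := by
      refine IsTopologicalGroup.t1Space G ?_
      have h1 : IsClosed (Subtype.val '' ({1} : Set N)) :=
        hclosed.isClosedEmbedding_subtypeVal.isClosedMap _ isClosed_singleton
      rwa [Set.image_singleton] at h1
    refine ⟨⟨?_⟩, inferInstance, ⟨fun t _ ht x hx y hy => ?_⟩⟩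
    · have hproper : IsProperMap ((↑) : G → G ⧸ N) := by
        refine isProperMap_iff_isClosedMap_and_compact_fibers.2
          ⟨continuous_quotient_mk', QuotientGroup.isClosedMap_coe hNc, fun y => ?_⟩
        obtain ⟨x, rfl⟩ := QuotientGroup.mk_surjective y
        have : ((↑) : G → G ⧸ N) ⁻¹' {(x : G ⧸ N)} = (fun n => x * n) '' (N : Set G) := by
          ext z
          rw [Set.mem_preimage, Set.mem_singleton_iff, eq_comm, QuotientGroup.eq]
          exact ⟨fun h => ⟨_, h, mul_inv_cancel_left x z⟩, by
            rintro ⟨n, hn, rfl⟩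
            rwa [inv_mul_cancel_left]⟩
        rw [this]
        exact hNc.image (continuous_const_mul x)
      exact hproper.isCompact_preimage isCompact_univ
    · have hNtd : IsTotallyDisconnected (N : Set G) := totallyDisconnectedSpace_subtype_iff.1 htd
      -- A connected set has a single point as image in G/N, so it lies in one coset and translates
      -- into the totally disconnected `N`.
      have hsub : ((fun z => x⁻¹ * z) '' t) ⊆ N := by
        rintro _ ⟨z, hz, rfl⟩
        have h1 : (x : G ⧸ N) = z :=
          (ht.image _ continuous_quotient_mk'.continuousOn).subsingleton ⟨x, hx, rfl⟩ ⟨z, hz, rfl⟩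
        exact QuotientGroup.eq.1 h1
      have h2 := hNtd _ hsub (ht.image _ (continuous_const_mul x⁻¹).continuousOn) ⟨x, hx, rfl⟩
        ⟨y, hy, rfl⟩
      exact mul_left_cancel h2

theorem proposition3 (k : ℕ) (hk : 1 ≤ k) (G : Type u) [Group G] [TopologicalSpace G]
    [IsTopologicalGroup G] (hG : IsStage k G) : IsGaloisHilbertian.{u, v, w} G := by
  obtain ⟨hc, ht, htd⟩ := hG.compactSpace_t2Space_totallyDisconnectedSpace
  refine ⟨inferInstance, hc, ht, htd, fun H _ _ K L _ _ _ _ hK ⟨e⟩ => ?_⟩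
  exact hG.isHilbertian K L hK (e.symm.toMulEquiv.toMonoidHom.comp (QuotientGroup.mk' H))
    (e.symm.continuous.comp continuous_quotient_mk')
    (e.symm.surjective.comp (QuotientGroup.mk'_surjective H))
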